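/- \textbf{Language.} The language of Set Matrix Theory (SMT) has Roman variables $x,y,z,u,\dots$ ranging over sets, Greek variables $\alpha,\beta,\gamma,\dots$ ranging over set matrices (every set being a set matrix), a constant $\emptyset$, the relations $=$ and $\in$, and for all positive integers $m,n$ an $mn$-ary function symbol $f_{m\times n}$; write $[t_{ij}]_{m\times n}$ for $f_{m\times n}(t_{11},\dots,t_{mn})$ and $[t]$ for $[t]_{1\times 1}$. The logic is classical first-order logic with equality, where any term may be substituted for a Greek variable, and only Roman variables for a Roman variable (that $t$ denotes a set is expressed by $\exists u\,(u=t)$). A theory $T$ is consistent if $T\not\vdash\bot$. \textbf{SMT$^-$} is the theory with the following axioms, for all positive integers $m,n,p,q$ and all formulas $\Phi$ (which may contain parameters): (1) $\forall\alpha_{11}\cdots\forall\alpha_{mn}\exists\beta:\ \beta=[\alpha_{ij}]_{m\times n}$; (2) $\forall x:\ [x]=x$; (3) $\forall\alpha_{11}\cdots\forall\alpha_{mn}:\ [[\alpha_{ij}]_{m\times n}]=[\alpha_{ij}]_{m\times n}$; (4) $\forall\alpha_{11}\cdots\forall\alpha_{mn}\forall\beta_{11}\cdots\forall\beta_{pq}:\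 [\alpha_{ij}]_{m\times n}\neq[\beta_{ij}]_{p\times q}$ whenever $(1,1)\neq(m,n)\neq(p,q)\neq(1,1)$; (5) $\forall\alpha_{11}\cdots\forall\alpha_{mn}\forall\beta_{11}\cdots\forall\beta_{mn}:\ [\alpha_{ij}]_{m\times n}=[\beta_{ij}]_{m\times n}\Leftrightarrow\alpha_{11}=\beta_{11}\wedge\dots\wedge\alpha_{mn}=\beta_{mn}$; (6) $\forall x\forall y:\ x=y\Leftrightarrow\forall\alpha(\alpha\in x\Leftrightarrow\alpha\in y)$; (7) $\exists x:\ x=\emptyset\wedge\forall\alpha(\alpha\notin x)$; (8) $\forall x\exists y\forall\alpha:\ \alpha\in y\Leftrightarrow\alpha\in x\wedge\Phi(\alpha)$ ($y$ not free in $\Phi$); (9) $\forall\alpha\forall\beta\exists x\forall\gamma:\ \gamma\in x\Leftrightarrow\gamma=\alpha\vee\gamma=\beta$; (10) $\forall x:\ \forall\alpha(\alpha\in x\Rightarrow\exists u(u=\alpha))\Rightarrow\exists y\forall\beta(\beta\in y\Leftrightarrow\exists z(z\in x\wedge\beta\in z))$; (11) $\forall x\exists y\forall\alpha:\ \alpha\in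 y\Leftrightarrow\exists u(u=\alpha\wedge\forall\beta(\beta\in u\Rightarrow\beta\in x))$; (12) $\exists x:\ \emptyset\in x\wedge\forall y(y\in x\Rightarrow\{y\}\in x)$, where $\{y\}\in x$ abbreviates $\exists z(z\in x\wedge\forall\gamma(\gamma\in z\Leftrightarrow\gamma=y))$; (13) $\forall x:\ \forall\alpha(\alpha\in x\Rightarrow\exists!\beta:\Phi(\alpha,\beta))\Rightarrow\exists y\forall\zeta(\zeta\in y\Leftrightarrow\exists\gamma:\gamma\in x\wedge\Phi(\gamma,\zeta))$ ($y$ not free in $\Phi$); (14) $\forall x\exists y\forall\alpha:\ \alpha\in y\Leftrightarrow\exists\beta_{11}\cdots\exists\beta_{mn}(\alpha=[\beta_{ij}]_{m\times n}\wedge\beta_{11}\in x\wedge\dots\wedge\beta_{mn}\in x)$. \textbf{SMT} is SMT$^-$ together with, for all positive integers $m,n$ with $m\cdot n\geq 2$, the epsilon axioms $\forall\alpha_{11}\cdots\forall\alpha_{mn}\forall\beta:\ \beta\notin[\alpha_{ij}]_{m\times n}$ and the set-versus-matrix division axioms $\forall x\forall\alpha_{11}\cdots\forall\alpha_{mn}:\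 x\neq[\alpha_{ij}]_{m\times n}$. \textbf{Proposition.} SMT is relatively consistent with SMT$^-$: if SMT$^-$ is consistent, then SMT is consistent. The same holds with regularity included: if SMT$^-$ together with the axiom $\forall x:\ \exists\alpha(\alpha\in x)\Rightarrow\exists\alpha\big(\alpha\in x\wedge\forall\beta(\beta\in\alpha\Rightarrow\beta\notin x)\big)$ is consistent, then so is SMT together with this axiom. -/

import Mathlib

/-! The first-order language of Set Matrix Theory, a Hilbert calculus for it, and its axioms. -/

namespace SetMatrix

/-- Variables: Roman variables range over sets, Greek variables range over set matrices. -/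
inductive Var where
  | roman (i : ℕ)
  | greek (i : ℕ)
  deriving DecidableEq

/-- Terms: variables, the constant `∅`, and `f_{m×n}(t₁₁, …, tₘₙ)` for positive `m`, `n`. -/
inductive Term where
  | var (v : Var)
  | empty
  | mat (m n : ℕ+) (t : Fin m → Fin n → Term)

/-- Formulas. The primitive logical symbols are `⊥`, `→`, `=` and `∀` (over both kinds of
variables); the other ones are defined below. -/
inductive Formula where
  | falsum
  | eq (s t : Term)
  | mem (s t : Term)
  | imp (φ ψ : Formula)
  | all (v : Var) (φ : Formula)

instance : Coe Var Term := ⟨Term.var⟩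

/-- The variable `v` occurs in the term. -/
def Term.Occurs (v : Var) : Term → Prop
  | .var w => w = v
  | .empty => False
  | .mat _ _ t => ∃ i j, (t i j).Occurs v

/-- `t.subst v s` is `t` with the variable `v` replaced by the term `s`. -/
def Term.subst (t : Term) (v : Var) (s : Term) : Term :=
  match t with
  | .var w => if w = v then s else .var w
  | .empty => .empty
  | .mat m n t => .mat m n fun i j => (t i j).subst v s

namespace Formula

/-- The variable `v` occurs free in the formula. -/
def Free (v : Var) : Formula → Prop
  | falsum => False
  | eq s t => s.Occurs v ∨ t.Occurs v
  | mem s t => s.Occurs v ∨ t.Occurs v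
  | imp φ ψ => φ.Free v ∨ ψ.Free v
  | all w φ => w ≠ v ∧ φ.Free v

/-- Replace the free occurrences of the variable `v` by the term `s`. -/
def subst (v : Var) (s : Term) : Formula → Formula
  | falsum => falsum
  | eq t t' => eq (t.subst v s) (t'.subst v s)
  | mem t t' => mem (t.subst v s) (t'.subst v s)
  | imp φ ψ => imp (φ.subst v s) (ψ.subst v s)
  | all w φ => if w = v then all w φ else all w (φ.subst v s)

/-- The term `s` is free for `v` in the formula: no variable of `s` is captured by a quantifier
when `s` is substituted for the free occurrences of `v`. -/
def FreeFor (s : Term) (v : Var) : Formula → Prop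
  | falsum => True
  | eq _ _ => True
  | mem _ _ => True
  | imp φ ψ => φ.FreeFor s v ∧ ψ.FreeFor s v
  | all w φ => ¬ (all w φ).Free v ∨ (¬ s.Occurs w ∧ φ.FreeFor s v)

def neg (φ : Formula) : Formula := φ.imp falsum
def or (φ ψ : Formula) : Formula := φ.neg.imp ψ
def and (φ ψ : Formula) : Formula := (φ.imp ψ.neg).neg
def iff (φ ψ : Formula) : Formula := (φ.imp ψ).and (ψ.imp φ)
def ex (v : Var) (φ : Formula) : Formula := (all v φ.neg).neg

/-- `∀ v₁ … ∀ vₖ φ` -/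
def alls (l : List Var) (φ : Formula) : Formula := l.foldr all φ

/-- `∃ v₁ … ∃ vₖ φ` -/
def exs (l : List Var) (φ : Formula) : Formula := l.foldr ex φ

/-- The conjunction of the formulas in a list. -/
def conj (l : List Formula) : Formula := l.foldr and (neg falsum)

end Formula

open Formula

/-- A term may be substituted for a variable of the given kind. Since Greek variables range over
all set matrices, and sets are set matrices, every term may be substituted for a Greek variable.
Only Roman variables may be substituted for a Roman variable, as other terms need not denote sets;
that a term `t` denotes a set is expressed by the formula `∃ u (u = t)`, with `u` Roman. -/
def Admissible (t : Term) : Var → Prop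
  | .roman _ => ∃ i, t = Term.var (.roman i)
  | .greek _ => True

/-- `Derives T φ`: the formula `φ` is derivable from the nonlogical axioms `T` in classical
first-order logic with equality (a Hilbert calculus with modus ponens and generalization; free
variables in nonlogical axioms are implicitly universally quantified). -/
inductive Derives (T : Set Formula) : Formula → Prop where
  | ax {φ : Formula} : φ ∈ T → Derives T φ
  | mp {φ ψ : Formula} : Derives T (φ.imp ψ) → Derives T φ → Derives T ψ
  | gen (v : Var) {φ : Formula} : Derives T φ → Derives T (all v φ)
  | imp_k (φ ψ : Formula) : Derives T (φ.imp (ψ.imp φ))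
  | imp_s (φ ψ χ : Formula) : Derives T ((φ.imp (ψ.imp χ)).imp ((φ.imp ψ).imp (φ.imp χ)))
  | dne (φ : Formula) : Derives T (φ.neg.neg.imp φ)
  | all_elim (v : Var) (t : Term) (φ : Formula) : Admissible t v → φ.FreeFor t v →
      Derives T ((all v φ).imp (φ.subst v t))
  | all_imp (v : Var) (φ ψ : Formula) : ¬ φ.Free v →
      Derives T ((all v (φ.imp ψ)).imp (φ.imp (all v ψ)))
  | eq_refl (t : Term) : Derives T (eq t t)
  | eq_subst (i : ℕ) (s t : Term) (φ : Formula) :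
      φ.FreeFor s (.greek i) → φ.FreeFor t (.greek i) →
      Derives T ((eq s t).imp ((φ.subst (.greek i) s).imp (φ.subst (.greek i) t)))

/-- A theory is consistent if it does not derive `⊥`. -/
def Consistent (T : Set Formula) : Prop := ¬ Derives T falsum

/-! ### Variables and abbreviations used to write the axioms -/

/-- Roman variables `x`, `y`, `z`, `u`. -/
def x : Var := .roman 0
def y : Var := .roman 1
def z : Var := .roman 2
def u : Var := .roman 3

/-- Greek variables `α`, `β`, `γ`. -/
def α : Var := .greek 0
def β : Var := .greek 1
def γ : Var := .greek 2

/-- The list of the Greek variables `greek c, …, greek (c + k - 1)`. -/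
def block (c k : ℕ) : List Var := (List.range k).map fun i => .greek (c + i)

/-- The term `f_{m×n}(α₁₁, …, αₘₙ)` whose entries, row by row, are the variables of
`block c (m * n)`. -/
def matVars (c : ℕ) (m n : ℕ+) : Term :=
  .mat m n fun i j => .var (.greek (c + (n * (i : ℕ) + (j : ℕ))))

/-- The term `[t] = f_{1×1}(t)`. -/
def single (t : Term) : Term := .mat 1 1 fun _ _ => t

/-- The formula `{v} ∈ t`, written out as `∃ z (z ∈ t ∧ ∀ γ (γ ∈ z ↔ γ = v))`. It is used only
where `v` and `t` are variables different from `z` and `γ`. -/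
def singletonMem (v t : Var) : Formula :=
  ex z ((mem z t).and (all γ ((mem γ z).iff (eq γ v))))

/-! ### Matrix-theoretical axioms -/

/-- `∀ α₁₁ … αₘₙ ∃ β, β = [αᵢⱼ]`, with `greek 0` as `β`. -/
def setMatrixAxiom (m n : ℕ+) : Formula :=
  alls (block 1 (m * n)) (ex (.greek 0) (eq (Var.greek 0) (matVars 1 m n)))

/-- `∀ x, [x] = x` -/
def reductionAxiom : Formula := all x (eq (single x) x)

/-- `∀ α₁₁ … αₘₙ, [[αᵢⱼ]] = [αᵢⱼ]` -/
def omissionAxiom (m n : ℕ+) : Formula :=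
  alls (block 0 (m * n)) (eq (single (matVars 0 m n)) (matVars 0 m n))

/-- `∀ x ∀ α₁₁ … αₘₙ, x ≠ [αᵢⱼ]` (assumed for `m * n ≥ 2`) -/
def divisionAxiomSets (m n : ℕ+) : Formula :=
  all x (alls (block 0 (m * n)) (eq x (matVars 0 m n)).neg)

/-- `∀ α₁₁ … αₘₙ ∀ β₁₁ … βₚq, [αᵢⱼ] ≠ [βᵢⱼ]`
(assumed for `(1,1) ≠ (m,n) ≠ (p,q) ≠ (1,1)`) -/
def divisionAxiomMatrices (m n p q : ℕ+) : Formula :=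
  alls (block 0 (m * n)) (alls (block (m * n) (p * q))
    (eq (matVars 0 m n) (matVars (m * n) p q)).neg)

/-- `∀ α₁₁ … αₘₙ ∀ β, β ∉ [αᵢⱼ]` (assumed for `m * n ≥ 2`), with `greek 0` as `β`. -/
def epsilonAxiom (m n : ℕ+) : Formula :=
  alls (block 1 (m * n)) (all (.greek 0) (mem (Var.greek 0) (matVars 1 m n)).neg)

/-- `∀ α₁₁ … αₘₙ ∀ β₁₁ … βₘₙ, [αᵢⱼ] = [βᵢⱼ] ↔ α₁₁ = β₁₁ ∧ … ∧ αₘₙ = βₘₙ` -/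
def matrixExtAxiom (m n : ℕ+) : Formula :=
  alls (block 0 (m * n)) (alls (block (m * n) (m * n))
    ((eq (matVars 0 m n) (matVars (m * n) m n)).iff
      (conj ((List.range (m * n)).map fun k => eq (Var.greek k) (Var.greek (m * n + k))))))

/-! ### Set-theoretical axioms -/

/-- `∀ x ∀ y, x = y ↔ ∀ α (α ∈ x ↔ α ∈ y)` -/
def setExtAxiom : Formula :=
  all x (all y ((eq x y).iff (all α ((mem α x).iff (mem α y)))))

/-- `∃ x, x = ∅ ∧ ∀ α (α ∉ x)` -/
def emptyAxiom : Formula :=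
  ex x ((eq x Term.empty).and (all α (mem α x).neg))

/-- `∀ x ∃ y ∀ α, α ∈ y ↔ α ∈ x ∧ Φ(α)`, with arbitrary variable names: `x = roman i`,
`y = roman j`, `α = greek a` (assumed for `i ≠ j` and `y` not free in `Φ`). The formula `Φ` may
have further free variables as parameters. -/
def separationAxiom (i j a : ℕ) (Φ : Formula) : Formula :=
  all (.roman i) (ex (.roman j) (all (.greek a)
    ((mem (Var.greek a) (Var.roman j)).iff ((mem (Var.greek a) (Var.roman i)).and Φ))))

/-- `∀ α ∀ β ∃ x ∀ γ, γ ∈ x ↔ γ = α ∨ γ = β` -/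
def pairAxiom : Formula :=
  all α (all β (ex x (all γ ((mem γ x).iff ((eq γ α).or (eq γ β))))))

/-- `∀ x, ∀ α (α ∈ x → ∃ u (u = α)) → ∃ y ∀ β (β ∈ y ↔ ∃ z (z ∈ x ∧ β ∈ z))` -/
def unionAxiom : Formula :=
  all x ((all α ((mem α x).imp (ex u (eq u α)))).imp
    (ex y (all β ((mem β y).iff (ex z ((mem z x).and (mem β z)))))))

/-- `∀ x ∃ y ∀ α, α ∈ y ↔ ∃ u (u = α ∧ u ⊆ x)`, where `u ⊆ x` is `∀ β (β ∈ u → β ∈ x)` -/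
def powerAxiom : Formula :=
  all x (ex y (all α ((mem α y).iff
    (ex u ((eq u α).and (all β ((mem β u).imp (mem β x))))))))

/-- `∃ x, ∅ ∈ x ∧ ∀ y (y ∈ x → {y} ∈ x)` -/
def infinityAxiom : Formula :=
  ex x ((mem Term.empty x).and (all y ((mem y x).imp (singletonMem y x))))

/-- `∀ x, ∀ α (α ∈ x → ∃! β Φ(α, β)) → ∃ y ∀ β (β ∈ y ↔ ∃ α (α ∈ x ∧ Φ(α, β)))`, with arbitrary
variable names: `x = roman i`, `y = roman j`, `α = greek a`, `β = greek b`. Here `∃! β Φ` is written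
out as `∃ γ ∀ β (Φ ↔ β = γ)` with `γ = greek c`. It is assumed for `i ≠ j`, `a ≠ b`, `c ≠ b` and
`y`, `γ` not free in `Φ`. The formula `Φ` may have further free variables as parameters. -/
def replacementAxiom (i j a b c : ℕ) (Φ : Formula) : Formula :=
  all (.roman i)
    ((all (.greek a) ((mem (Var.greek a) (Var.roman i)).imp
      (ex (.greek c) (all (.greek b) (Φ.iff (eq (Var.greek b) (Var.greek c))))))).imp
    (ex (.roman j) (all (.greek b) ((mem (Var.greek b) (Var.roman j)).iff
      (ex (.greek a) ((mem (Var.greek a) (Var.roman i)).and Φ))))))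

/-- `∀ x ∃ y ∀ α, α ∈ y ↔ ∃ β₁₁ … βₘₙ (α = [βᵢⱼ] ∧ β₁₁ ∈ x ∧ … ∧ βₘₙ ∈ x)` -/
def setOfMatricesAxiom (m n : ℕ+) : Formula :=
  all x (ex y (all α ((mem α y).iff
    (exs (block 1 (m * n)) ((eq α (matVars 1 m n)).and
      (conj ((List.range (m * n)).map fun k => mem (Var.greek (1 + k)) x)))))))

/-- Regularity: `∀ x, ∃ α (α ∈ x) → ∃ α (α ∈ x ∧ ∀ β (β ∈ α → β ∉ x))` -/
def regularityAxiom : Formula :=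
  all x ((ex α (mem α x)).imp
    (ex α ((mem α x).and (all β ((mem β α).imp (mem β x).neg)))))

/-! ### The theories -/

/-- The division axioms between sets and matrices. -/
def divisionSchemaSets : Set Formula :=
  {σ | ∃ m n : ℕ+, 2 ≤ (m * n : ℕ) ∧ σ = divisionAxiomSets m n}

/-- The epsilon axioms. -/
def epsilonSchema : Set Formula :=
  {σ | ∃ m n : ℕ+, 2 ≤ (m * n : ℕ) ∧ σ = epsilonAxiom m n}

/-- The axioms of SMT⁻ (regularity not included). -/
inductive IsSMTminusAxiom : Formula → Prop where
  | setMatrix (m n : ℕ+) : IsSMTminusAxiom (setMatrixAxiom m n)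
  | reduction : IsSMTminusAxiom reductionAxiom
  | omission (m n : ℕ+) : IsSMTminusAxiom (omissionAxiom m n)
  | divisionMatrices (m n p q : ℕ+) : ((1, 1) : ℕ+ × ℕ+) ≠ (m, n) → (m, n) ≠ (p, q) →
      (p, q) ≠ (1, 1) → IsSMTminusAxiom (divisionAxiomMatrices m n p q)
  | matrixExt (m n : ℕ+) : IsSMTminusAxiom (matrixExtAxiom m n)
  | setExt : IsSMTminusAxiom setExtAxiom
  | empty : IsSMTminusAxiom emptyAxiom
  | separation (i j a : ℕ) (Φ : Formula) : i ≠ j → ¬ Φ.Free (.roman j) →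
      IsSMTminusAxiom (separationAxiom i j a Φ)
  | pair : IsSMTminusAxiom pairAxiom
  | union : IsSMTminusAxiom unionAxiom
  | power : IsSMTminusAxiom powerAxiom
  | infinity : IsSMTminusAxiom infinityAxiom
  | replacement (i j a b c : ℕ) (Φ : Formula) : i ≠ j → a ≠ b → c ≠ b → ¬ Φ.Free (.roman j) →
      ¬ Φ.Free (.greek c) → IsSMTminusAxiom (replacementAxiom i j a b c Φ)
  | setOfMatrices (m n : ℕ+) : IsSMTminusAxiom (setOfMatricesAxiom m n)

/-- SMT⁻: Set Matrix Theory without the epsilon schema and without the division schema for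
sets and matrices. -/
def SMTminus : Set Formula := {σ | IsSMTminusAxiom σ}

/-- Set Matrix Theory. -/
def SMT : Set Formula := SMTminus ∪ epsilonSchema ∪ divisionSchemaSets

end SetMatrix

/-!
SMT is interpreted in SMT⁻, even with regularity included and whether or not SMT⁻ includes it.

By the completeness theorem for the calculus (`exists_model`), a consistent SMT⁻ has a model `M`, in
which matrices may be sets or have elements. A model of SMT is defined inside `M`. The sets of the
new model are codes of sets of `M`: a set `s` is coded by the matrix `[s s s]`, except that `∅` is
coded by `[∅ ∅]`, and `{[z z]}` by `[{z} {z}]` for every set `z` (`Str.Code`). A new matrix, unless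
it is `1 × 1`, is an old one with a further row of `∅`s (`Str.pad`), so that it has at least two rows and cannot be a
code. An object is an element of a code if it belongs to the set coded, and padded matrices have no
elements; this gives the epsilon axioms and the division between sets and matrices. Since the
elements of a set of `M` are arbitrary objects of `M`, no recursion along the membership relation is
needed. The two exceptions in the coding serve the axiom of infinity: from the set `Z` that `M`
provides, one obtains `{[z z] : z ∈ Z}`, which contains the new `∅` and is closed under new
singletons.

The domain is restricted to the objects `a` such that every set containing `a` has a minimal
element for the new membership relation (`Str.WF`). An object is of this kind if and only if all its
elements are (`Str.Basic.wf_of_codeMem`, `Str.wf_of_codeMem_wf`), so that the restriction preserves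
the axioms, and it forces regularity. Regularity of `M` would not suffice for this, as it does not
exclude `s = {[s s s]}`.

The construction is definable in `M` (`Str.sat_tr`), which yields separation and replacement. All
axioms hold in the result (`Str.interp_models`), and so SMT with regularity is consistent by
soundness (`Str.sound`).
-/

namespace SetMatrix
open Formula

/-! ### Structures and soundness -/

/-- A structure for the language of set matrices: `S` is the predicate "is a set", over which the
Roman variables range; the Greek variables range over the whole carrier. -/
structure Str where
  D : Type
  S : D → Prop
  /-- the interpretation of `f_{m×n}` -/
  f : (m n : ℕ+) → (Fin m → Fin n → D) → D
  /-- the interpretation of `∅` -/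
  e : D
  mem : D → D → Prop

namespace Str

variable (M : Str)

/-- `d` belongs to the range of the variable `v`. -/
def Ok : Var → M.D → Prop
  | .roman _, d => M.S d
  | .greek _, _ => True

/-- The assignment `σ` sends Roman variables to sets. -/
def Good (σ : Var → M.D) : Prop := ∀ v, M.Ok v (σ v)

/-- The value of a term under the assignment `σ`. -/
def eval (σ : Var → M.D) : Term → M.D
  | .var v => σ v
  | .empty => M.e
  | .mat m n t => M.f m n fun i j => eval σ (t i j)

/-- Satisfaction of a formula in `M` under an assignment. -/
def sat : Formula → (Var → M.D) → Prop
  | falsum, _ => False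
  | .eq s t, σ => M.eval σ s = M.eval σ t
  | .mem s t, σ => M.mem (M.eval σ s) (M.eval σ t)
  | imp φ ψ, σ => sat φ σ → sat ψ σ
  | all v φ, σ => ∀ d, M.Ok v d → sat φ (Function.update σ v d)

/-- All formulas of `T` hold in `M` under all assignments. -/
def Models (T : Set Formula) : Prop := ∀ φ ∈ T, ∀ σ, M.Good σ → M.sat φ σ

variable {M} {σ ρ : Var → M.D} {φ ψ : Formula} {v : Var}

@[simp] theorem eval_var (w : Var) : M.eval σ (.var w) = σ w := rfl
@[simp] theorem eval_empty : M.eval σ .empty = M.e := rfl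
@[simp] theorem eval_mat (m n : ℕ+) (t : Fin m → Fin n → Term) :
    M.eval σ (.mat m n t) = M.f m n fun i j => M.eval σ (t i j) := rfl
@[simp] theorem ok_roman (i : ℕ) (d : M.D) : M.Ok (.roman i) d ↔ M.S d := Iff.rfl
@[simp] theorem ok_greek (i : ℕ) (d : M.D) : M.Ok (.greek i) d := trivial
@[simp] theorem sat_falsum : ¬ M.sat falsum σ := fun h => h
@[simp] theorem sat_eq (s t : Term) : M.sat (.eq s t) σ ↔ M.eval σ s = M.eval σ t := Iff.rfl
@[simp] theorem sat_mem (s t : Term) :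
    M.sat (.mem s t) σ ↔ M.mem (M.eval σ s) (M.eval σ t) := Iff.rfl
@[simp] theorem sat_imp : M.sat (imp φ ψ) σ ↔ (M.sat φ σ → M.sat ψ σ) := Iff.rfl
@[simp] theorem sat_all : M.sat (all v φ) σ ↔
    ∀ d, M.Ok v d → M.sat φ (Function.update σ v d) := Iff.rfl
@[simp] theorem sat_neg : M.sat φ.neg σ ↔ ¬ M.sat φ σ := Iff.rfl
@[simp] theorem sat_or : M.sat (φ.or ψ) σ ↔ M.sat φ σ ∨ M.sat ψ σ := by
  simp only [Formula.or, sat_imp, sat_neg]; tauto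
@[simp] theorem sat_and : M.sat (φ.and ψ) σ ↔ M.sat φ σ ∧ M.sat ψ σ := by
  simp only [Formula.and, sat_imp, sat_neg]; tauto
@[simp] theorem sat_iff : M.sat (φ.iff ψ) σ ↔ (M.sat φ σ ↔ M.sat ψ σ) := by
  simp only [Formula.iff, sat_imp, sat_and]; tauto
@[simp] theorem sat_ex : M.sat (ex v φ) σ ↔
    ∃ d, M.Ok v d ∧ M.sat φ (Function.update σ v d) := by
  simp only [ex, sat_all, sat_neg]; push Not; rfl

theorem sat_conj (l : List Formula) : M.sat (conj l) σ ↔ ∀ φ ∈ l, M.sat φ σ := by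
  induction l with
  | nil => simp [conj]
  | cons a l ih =>
    have : conj (a :: l) = a.and (conj l) := rfl
    simp [this, ih]

theorem Good.update (h : M.Good σ) {d : M.D} (hd : M.Ok v d) :
    M.Good (Function.update σ v d) := by
  intro w
  by_cases hw : w = v
  · subst hw; simpa using hd
  · simpa [hw] using h w

theorem eval_congr {t : Term} (h : ∀ v, t.Occurs v → σ v = ρ v) : M.eval σ t = M.eval ρ t := by
  induction t with
  | var w => exact h w rfl
  | empty => rfl
  | mat m n t ih =>
    simp only [eval_mat]
    congr 1; funext i j
    exact ih i j fun v hv => h v ⟨i, j, hv⟩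

theorem sat_congr (h : ∀ v, φ.Free v → σ v = ρ v) : M.sat φ σ ↔ M.sat φ ρ := by
  induction φ generalizing σ ρ with
  | falsum => rfl
  | eq s t =>
    rw [sat_eq, sat_eq, eval_congr fun v hv => h v (.inl hv), eval_congr fun v hv => h v (.inr hv)]
  | mem s t =>
    rw [sat_mem, sat_mem, eval_congr fun v hv => h v (.inl hv),
      eval_congr fun v hv => h v (.inr hv)]
  | imp φ ψ ih₁ ih₂ =>
    rw [sat_imp, sat_imp, ih₁ fun v hv => h v (.inl hv), ih₂ fun v hv => h v (.inr hv)]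
  | all w φ ih =>
    rw [sat_all, sat_all]
    refine forall₂_congr fun d _ => ih fun v hv => ?_
    by_cases hw : v = w
    · subst hw; simp
    · simpa [hw] using h v ⟨fun e => hw e.symm, hv⟩

theorem sat_update_of_not_free (h : ¬ φ.Free v) (d : M.D) :
    M.sat φ (Function.update σ v d) ↔ M.sat φ σ :=
  sat_congr fun w hw => Function.update_of_ne (by rintro rfl; exact h hw) _ _

theorem eval_update_of_not_occurs {t : Term} (h : ¬ t.Occurs v) (d : M.D) :
    M.eval (Function.update σ v d) t = M.eval σ t :=
  eval_congr fun w hw => Function.update_of_ne (by rintro rfl; exact h hw) _ _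

theorem eval_subst (s t : Term) :
    M.eval σ (s.subst v t) = M.eval (Function.update σ v (M.eval σ t)) s := by
  induction s with
  | var w =>
    by_cases hw : w = v
    · subst hw; simp [Term.subst]
    · simp [Term.subst, hw]
  | empty => rfl
  | mat m n s ih => simp only [Term.subst, eval_mat, ih]

/-- The substitution lemma. -/
theorem sat_subst {t : Term} (h : φ.FreeFor t v) :
    M.sat (φ.subst v t) σ ↔ M.sat φ (Function.update σ v (M.eval σ t)) := by
  induction φ generalizing σ with
  | falsum => rfl
  | eq s s' => simp only [Formula.subst, sat_eq, eval_subst]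
  | mem s s' => simp only [Formula.subst, sat_mem, eval_subst]
  | imp φ ψ ih₁ ih₂ => simp only [Formula.subst, sat_imp, ih₁ h.1, ih₂ h.2]
  | all w φ ih =>
    by_cases hw : w = v
    · subst hw
      simp [Formula.subst]
    · simp only [Formula.subst, hw, if_false, sat_all]
      refine forall₂_congr fun d _ => ?_
      rcases h with h | ⟨h₁, h₂⟩
      · have hv : ¬ φ.Free v := fun hv => h ⟨hw, hv⟩
        have : φ.FreeFor t v := by
          clear ih h
          induction φ with
          | falsum => trivial
          | eq => trivial
          | mem => trivial
          | imp φ ψ ih₁ ih₂ =>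
            exact ⟨ih₁ fun h => hv (.inl h), ih₂ fun h => hv (.inr h)⟩
          | all => exact .inl hv
        rw [ih this, sat_update_of_not_free hv, Function.update_comm (Ne.symm hw),
          sat_update_of_not_free hv]
      · rw [ih h₂, eval_update_of_not_occurs h₁, Function.update_comm hw]

/-- The Hilbert calculus is sound. In the case of `all_elim` for a Roman variable, admissibility
ensures that the value of the substituted term is a set. -/
theorem sound {T : Set Formula} (hM : M.Models T) (h : Derives T φ) :
    ∀ σ, M.Good σ → M.sat φ σ := by
  induction h with
  | ax h => exact hM _ h
  | mp _ _ ih₁ ih₂ => exact fun σ hσ => ih₁ σ hσ (ih₂ σ hσ)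
  | gen v _ ih => exact fun σ hσ d hd => ih _ (hσ.update hd)
  | imp_k φ ψ => exact fun σ _ h _ => h
  | imp_s φ ψ χ => exact fun σ _ h h' h'' => h h'' (h' h'')
  | dne φ => exact fun σ _ h => not_not.1 h
  | all_elim v t φ ht hf =>
    intro σ hσ h
    rw [sat_subst hf]
    refine h _ ?_
    cases v with
    | roman i => obtain ⟨k, rfl⟩ := ht; exact hσ (.roman k)
    | greek i => trivial
  | all_imp v φ ψ hv =>
    exact fun σ _ h h' d hd => h d hd ((sat_update_of_not_free hv d).2 h')
  | eq_refl t => exact fun σ _ => rfl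
  | eq_subst i s t φ hs ht =>
    intro σ _ h h'
    rw [sat_subst hs] at h'
    rw [sat_subst ht, ← (sat_eq _ _).1 h]
    exact h'

theorem consistent {T : Set Formula} (hM : M.Models T) (hσ : M.Good σ) : Consistent T :=
  fun h => sound hM h σ hσ

end Str

/-! ### Syntax: fresh variables and countability -/

/-- The index of a variable among the variables of its kind. -/
def Var.idx : Var → ℕ
  | .roman i => i
  | .greek i => i

/-- The variable of the same kind as `v` with index `k`. -/
def Var.withIdx : Var → ℕ → Var
  | .roman _, k => .roman k
  | .greek _, k => .greek k

@[simp] theorem Var.idx_withIdx (v : Var) (k : ℕ) : (v.withIdx k).idx = k := by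
  cases v <;> rfl

@[simp] theorem Var.withIdx_idx (v : Var) : v.withIdx v.idx = v := by
  cases v <;> rfl

@[simp] theorem Var.withIdx_withIdx (v : Var) (k l : ℕ) :
    (v.withIdx k).withIdx l = v.withIdx l := by
  cases v <;> rfl

theorem admissible_withIdx (v : Var) (k : ℕ) : Admissible (.var (v.withIdx k)) v := by
  cases v
  · exact ⟨k, rfl⟩
  · trivial

theorem admissible_withIdx_iff {t : Term} {v : Var} (k : ℕ) :
    Admissible t (v.withIdx k) ↔ Admissible t v := by
  cases v <;> rfl

theorem admissible_self (v : Var) : Admissible (.var v) v := by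
  simpa using admissible_withIdx v v.idx

/-- A strict upper bound for the indices of the variables of a term. -/
def Term.bd : Term → ℕ
  | .var v => v.idx + 1
  | .empty => 0
  | .mat _ _ t => Finset.univ.sup fun i => Finset.univ.sup fun j => (t i j).bd

/-- A strict upper bound for the indices of the variables, free or bound, of a formula. -/
def Formula.bd : Formula → ℕ
  | falsum => 0
  | .eq s t => max s.bd t.bd
  | .mem s t => max s.bd t.bd
  | imp φ ψ => max φ.bd ψ.bd
  | all v φ => max (v.idx + 1) φ.bd

theorem Term.bd_entry_le {m n : ℕ+} (t : Fin m → Fin n → Term) (i : Fin m) (j : Fin n) :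
    (t i j).bd ≤ (Term.mat m n t).bd :=
  (Finset.le_sup (f := fun j => (t i j).bd) (Finset.mem_univ j)).trans
    (Finset.le_sup (f := fun i => Finset.univ.sup fun j => (t i j).bd) (Finset.mem_univ i))

theorem Term.Occurs.lt_bd {t : Term} {v : Var} (h : t.Occurs v) : v.idx < t.bd := by
  induction t with
  | var w => cases h; exact Nat.lt_succ_self _
  | empty => exact h.elim
  | mat m n t ih =>
    obtain ⟨i, j, h⟩ := h
    exact (ih i j h).trans_le (Term.bd_entry_le t i j)

theorem Term.not_occurs {t : Term} {v : Var} (h : t.bd ≤ v.idx) : ¬ t.Occurs v :=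
  fun h' => h'.lt_bd.not_ge h

theorem Formula.Free.lt_bd {φ : Formula} {v : Var} (h : φ.Free v) : v.idx < φ.bd := by
  induction φ with
  | falsum => exact h.elim
  | eq s t => exact lt_max_iff.2 (h.imp Term.Occurs.lt_bd Term.Occurs.lt_bd)
  | mem s t => exact lt_max_iff.2 (h.imp Term.Occurs.lt_bd Term.Occurs.lt_bd)
  | imp φ ψ ih₁ ih₂ => exact lt_max_iff.2 (h.imp ih₁ ih₂)
  | all w φ ih => exact lt_max_iff.2 (.inr (ih h.2))

theorem Formula.not_free {φ : Formula} {v : Var} (h : φ.bd ≤ v.idx) : ¬ φ.Free v :=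
  fun h' => h'.lt_bd.not_ge h

theorem Term.subst_of_not_occurs {t : Term} {v : Var} (h : ¬ t.Occurs v) (s : Term) :
    t.subst v s = t := by
  induction t with
  | var w => exact if_neg h
  | empty => rfl
  | mat m n t ih =>
    simp only [Term.subst, Term.mat.injEq, heq_eq_eq, true_and]
    funext i j
    exact ih i j fun h' => h ⟨i, j, h'⟩

theorem Term.subst_self (t : Term) (v : Var) : t.subst v (.var v) = t := by
  induction t with
  | var w => by_cases h : w = v <;> simp [Term.subst, h]
  | empty => rfl
  | mat m n t ih => simp only [Term.subst, ih]

theorem Formula.subst_self (φ : Formula) (v : Var) : φ.subst v (.var v) = φ := by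
  induction φ with
  | falsum => rfl
  | eq s t => simp only [Formula.subst, Term.subst_self]
  | mem s t => simp only [Formula.subst, Term.subst_self]
  | imp φ ψ ih₁ ih₂ => simp only [Formula.subst, ih₁, ih₂]
  | all w φ ih => simp only [Formula.subst, ih, ite_self]

theorem Formula.freeFor_self (φ : Formula) (v : Var) : φ.FreeFor (.var v) v := by
  induction φ with
  | falsum => trivial
  | eq s t => trivial
  | mem s t => trivial
  | imp φ ψ ih₁ ih₂ => exact ⟨ih₁, ih₂⟩
  | all w φ ih =>
    by_cases h : w = v
    · exact .inl fun h' => h'.1 h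
    · exact .inr ⟨fun h' => h (Eq.symm h'), ih⟩

theorem Formula.freeFor_fresh {φ : Formula} {w : Var} (h : φ.bd ≤ w.idx) (v : Var) :
    φ.FreeFor (.var w) v := by
  induction φ with
  | falsum => trivial
  | eq s t => trivial
  | mem s t => trivial
  | imp φ ψ ih₁ ih₂ =>
    exact ⟨ih₁ (le_trans (le_max_left _ _) h), ih₂ (le_trans (le_max_right _ _) h)⟩
  | all a φ ih =>
    refine .inr ⟨?_, ih (le_trans (le_max_right _ _) h)⟩
    rintro rfl
    exact absurd (le_trans (le_max_left _ _) h) (Nat.not_succ_le_self _)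

theorem Term.subst_subst_fresh {t : Term} {w : Var} (h : ¬ t.Occurs w) (v : Var) :
    (t.subst v (.var w)).subst w (.var v) = t := by
  induction t with
  | var a =>
    by_cases hv : a = v
    · simp [Term.subst, hv]
    · have : a ≠ w := h
      simp [Term.subst, hv, this]
  | empty => rfl
  | mat m n t ih =>
    simp only [Term.subst, Term.mat.injEq, heq_eq_eq, true_and]
    funext i j
    exact ih i j fun h' => h ⟨i, j, h'⟩

/-- Replacing `v` by a fresh variable `w` is undone by replacing `w` by `v`. -/
theorem Formula.subst_subst_fresh {φ : Formula} {w : Var} (h : φ.bd ≤ w.idx) (v : Var) :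
    (φ.subst v (.var w)).subst w (.var v) = φ ∧ (φ.subst v (.var w)).FreeFor (.var v) w := by
  induction φ with
  | falsum => exact ⟨rfl, trivial⟩
  | eq s t =>
    refine ⟨?_, trivial⟩
    simp only [Formula.subst]
    rw [Term.subst_subst_fresh (Term.not_occurs (le_trans (le_max_left _ _) h)),
      Term.subst_subst_fresh (Term.not_occurs (le_trans (le_max_right _ _) h))]
  | mem s t =>
    refine ⟨?_, trivial⟩
    simp only [Formula.subst]
    rw [Term.subst_subst_fresh (Term.not_occurs (le_trans (le_max_left _ _) h)),
      Term.subst_subst_fresh (Term.not_occurs (le_trans (le_max_right _ _) h))]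
  | imp φ ψ ih₁ ih₂ =>
    obtain ⟨h₁, h₁'⟩ := ih₁ (le_trans (le_max_left _ _) h)
    obtain ⟨h₂, h₂'⟩ := ih₂ (le_trans (le_max_right _ _) h)
    exact ⟨by simp only [Formula.subst, h₁, h₂], h₁', h₂'⟩
  | all a φ ih =>
    have hb : φ.bd ≤ w.idx := le_trans (le_max_right _ _) h
    obtain ⟨h₁, h₂⟩ := ih hb
    have ha : a ≠ w := by
      rintro rfl
      exact absurd (le_trans (le_max_left _ _) h) (Nat.not_succ_le_self _)
    by_cases hv : a = v
    · subst hv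
      have hw : ¬ φ.Free w := Formula.not_free hb
      have e : φ.subst w (.var a) = φ := by
        clear ih h₁ h₂ h hb
        induction φ with
        | falsum => rfl
        | eq s t =>
          simp only [Formula.subst]
          rw [Term.subst_of_not_occurs fun h => hw (.inl h),
            Term.subst_of_not_occurs fun h => hw (.inr h)]
        | mem s t =>
          simp only [Formula.subst]
          rw [Term.subst_of_not_occurs fun h => hw (.inl h),
            Term.subst_of_not_occurs fun h => hw (.inr h)]
        | imp φ ψ ih₁ ih₂ =>
          simp only [Formula.subst]
          rw [ih₁ fun h => hw (.inl h), ih₂ fun h => hw (.inr h)]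
        | all b φ ih =>
          by_cases hb : b = w
          · simp [Formula.subst, hb]
          · simp [Formula.subst, hb, ih fun h => hw ⟨hb, h⟩]
      simp only [Formula.subst, if_true, ha, if_false, e, true_and]
      exact .inl fun h' => hw h'.2
    · simp only [Formula.subst, hv, ha, if_false, h₁, true_and]
      exact .inr ⟨fun h' => hv (Eq.symm h'), h₂⟩

/-- The nesting depth of a term. -/
def Term.depth : Term → ℕ
  | .var _ => 0
  | .empty => 0
  | .mat _ _ t => (Finset.univ.sup fun i => Finset.univ.sup fun j => (t i j).depth) + 1

/-- The nesting depth of a formula. -/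
def Formula.depth : Formula → ℕ
  | falsum => 0
  | .eq _ _ => 0
  | .mem _ _ => 0
  | imp φ ψ => max φ.depth ψ.depth + 1
  | all _ φ => φ.depth + 1

theorem Formula.depth_subst (φ : Formula) (v : Var) (s : Term) :
    (φ.subst v s).depth = φ.depth := by
  induction φ with
  | falsum => rfl
  | eq s t => rfl
  | mem s t => rfl
  | imp φ ψ ih₁ ih₂ => simp only [Formula.subst, Formula.depth, ih₁, ih₂]
  | all w φ ih =>
    by_cases h : w = v <;> simp [Formula.subst, Formula.depth, ih, h]

instance : Countable Var :=
  Function.Injective.countable (f := fun v : Var => (decide (v = .roman v.idx), v.idx)) <| by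
    rintro (i | i) (j | j) h <;> simp_all [Var.idx]

instance : Countable Term := by
  have key : ∀ k, {t : Term | t.depth ≤ k}.Countable := by
    intro k
    induction k with
    | zero =>
      refine ((Set.countable_range Term.var).union (Set.countable_singleton Term.empty)).mono ?_
      rintro (v | _ | ⟨m, n, t⟩) h
      · exact .inl ⟨v, rfl⟩
      · exact .inr rfl
      · exact absurd h (Nat.not_succ_le_zero _)
    | succ k ih =>
      have := ih.to_subtype
      refine (ih.union (Set.countable_iUnion fun m : ℕ+ => Set.countable_iUnion fun n : ℕ+ =>
        Set.countable_range fun t : Fin m → Fin n → {t : Term | t.depth ≤ k} =>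
          Term.mat m n fun i j => (t i j : Term))).mono ?_
      rintro (v | _ | ⟨m, n, t⟩) h
      · exact .inl (Nat.zero_le _)
      · exact .inl (Nat.zero_le _)
      · refine .inr (Set.mem_iUnion.2 ⟨m, Set.mem_iUnion.2 ⟨n, fun i j => ⟨t i j, ?_⟩, rfl⟩⟩)
        exact (Finset.le_sup (f := fun j => (t i j).depth) (Finset.mem_univ j)).trans
          ((Finset.le_sup (f := fun i => Finset.univ.sup fun j => (t i j).depth)
            (Finset.mem_univ i)).trans (Nat.succ_le_succ_iff.1 h))
  refine Set.countable_univ_iff.1 ((Set.countable_iUnion key).mono fun t _ => ?_)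
  exact Set.mem_iUnion.2 ⟨t.depth, le_refl t.depth⟩

instance : Countable Formula := by
  have key : ∀ k, {φ : Formula | φ.depth ≤ k}.Countable := by
    intro k
    induction k with
    | zero =>
      refine (((Set.countable_singleton falsum).union
        (Set.countable_range fun p : Term × Term => Formula.eq p.1 p.2)).union
        (Set.countable_range fun p : Term × Term => Formula.mem p.1 p.2)).mono ?_
      rintro (_ | ⟨s, t⟩ | ⟨s, t⟩ | ⟨φ, ψ⟩ | ⟨v, φ⟩) h
      · exact .inl (.inl rfl)
      · exact .inl (.inr ⟨(s, t), rfl⟩)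
      · exact .inr ⟨(s, t), rfl⟩
      · exact absurd h (Nat.not_succ_le_zero _)
      · exact absurd h (Nat.not_succ_le_zero _)
    | succ k ih =>
      refine ((ih.union (ih.image2 ih imp)).union
        ((Set.countable_univ (α := Var)).image2 ih all)).mono ?_
      rintro (_ | ⟨s, t⟩ | ⟨s, t⟩ | ⟨φ, ψ⟩ | ⟨v, φ⟩) h
      · exact .inl (.inl (Nat.zero_le _))
      · exact .inl (.inl (Nat.zero_le _))
      · exact .inl (.inl (Nat.zero_le _))
      · have h' := Nat.succ_le_succ_iff.1 h
        exact .inl (.inr ⟨φ, (le_max_left _ _).trans h', ψ, (le_max_right _ _).trans h', rfl⟩)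
      · exact .inr ⟨v, trivial, φ, Nat.succ_le_succ_iff.1 h, rfl⟩
  refine Set.countable_univ_iff.1 ((Set.countable_iUnion key).mono fun φ _ => ?_)
  exact Set.mem_iUnion.2 ⟨φ.depth, le_refl φ.depth⟩

/-! ### Derivations from hypotheses -/

/-- Derivability from the theorems of `T` and the hypotheses `Γ` by modus ponens alone, so that
the free variables of `Γ` behave like constants. -/
inductive Prf (T Γ : Set Formula) : Formula → Prop where
  | hyp {φ : Formula} : φ ∈ Γ → Prf T Γ φ
  | thm {φ : Formula} : Derives T φ → Prf T Γ φ
  | mp {φ ψ : Formula} : Prf T Γ (φ.imp ψ) → Prf T Γ φ → Prf T Γ ψ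

section Prf

variable {T Γ Δ : Set Formula} {φ ψ χ : Formula}

theorem Prf.mono (h : Γ ⊆ Δ) (hp : Prf T Γ φ) : Prf T Δ φ := by
  induction hp with
  | hyp h' => exact .hyp (h h')
  | thm h' => exact .thm h'
  | mp _ _ ih₁ ih₂ => exact .mp ih₁ ih₂

theorem Prf.derives (hp : Prf T ∅ φ) : Derives T φ := by
  induction hp with
  | hyp h => exact h.elim
  | thm h => exact h
  | mp _ _ ih₁ ih₂ => exact .mp ih₁ ih₂

theorem derives_id (T : Set Formula) (φ : Formula) : Derives T (φ.imp φ) :=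
  .mp (.mp (.imp_s φ (φ.imp φ) φ) (.imp_k φ (φ.imp φ))) (.imp_k φ φ)

/-- The deduction theorem. -/
theorem Prf.ded (hp : Prf T (insert ψ Γ) φ) : Prf T Γ (ψ.imp φ) := by
  induction hp with
  | hyp h =>
    rcases h with rfl | h
    · exact .thm (derives_id T _)
    · exact .mp (.thm (.imp_k _ _)) (.hyp h)
  | thm h => exact .mp (.thm (.imp_k _ _)) (.thm h)
  | mp _ _ ih₁ ih₂ => exact .mp (.mp (.thm (.imp_s _ _ _)) ih₁) ih₂

theorem Prf.by_contra (hp : Prf T (insert φ.neg Γ) falsum) : Prf T Γ φ :=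
  .mp (.thm (.dne φ)) hp.ded

theorem Prf.all_elim (v : Var) (t : Term) (ha : Admissible t v) (hf : φ.FreeFor t v)
    (h : Prf T Γ (all v φ)) : Prf T Γ (φ.subst v t) :=
  .mp (.thm (.all_elim v t φ ha hf)) h

theorem derives_all_imp_all (T : Set Formula) (v : Var) (φ ψ : Formula) :
    Derives T ((all v (φ.imp ψ)).imp ((all v φ).imp (all v ψ))) := by
  have key : Derives T ((all v (φ.imp ψ)).imp ((all v φ).imp ψ)) := by
    refine Prf.derives (Prf.ded (Prf.ded ?_))
    have h₁ := Prf.all_elim (T := T) (Γ := insert (all v φ) (insert (all v (φ.imp ψ)) ∅)) v _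
      (admissible_self v) (Formula.freeFor_self (φ.imp ψ) v) (.hyp (by simp))
    have h₂ := Prf.all_elim (T := T) (Γ := insert (all v φ) (insert (all v (φ.imp ψ)) ∅)) v _
      (admissible_self v) (Formula.freeFor_self φ v) (.hyp (by simp))
    rw [Formula.subst_self] at h₁ h₂
    exact .mp h₁ h₂
  have h₁ : Derives T ((all v (φ.imp ψ)).imp (all v ((all v φ).imp ψ))) :=
    .mp (.all_imp v _ _ fun h => h.1 rfl) (.gen v key)
  refine Prf.derives (Prf.ded ?_)
  exact .mp (.thm (.all_imp v _ _ fun h => h.1 rfl)) (.mp (.thm h₁) (.hyp (by simp)))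

/-- Generalization over a variable that is not free in the hypotheses. -/
theorem Prf.gen {v : Var} (hv : ∀ ψ ∈ Γ, ¬ ψ.Free v) (hp : Prf T Γ φ) : Prf T Γ (all v φ) := by
  induction hp with
  | hyp h =>
    exact .mp (.thm (.mp (.all_imp v _ _ (hv _ h)) (.gen v (derives_id T _)))) (.hyp h)
  | thm h => exact .thm (.gen v h)
  | mp _ _ ih₁ ih₂ => exact .mp (.mp (.thm (derives_all_imp_all T v _ _)) ih₁) ih₂

/-- Generalization over a fresh variable `w` put in place of `v` yields generalization over `v`. -/
theorem Prf.all_of_all_fresh {v w : Var} {k : ℕ} (hw : w = v.withIdx k) (hb : φ.bd ≤ k)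
    (h : Prf T Γ (all w (φ.subst v (.var w)))) : Prf T Γ (all v φ) := by
  subst hw
  obtain ⟨h₁, h₂⟩ := Formula.subst_subst_fresh (φ := φ) (w := v.withIdx k) (by simpa using hb) v
  have ha : Admissible (.var v) (v.withIdx k) :=
    (admissible_withIdx_iff k).2 (admissible_self v)
  have h₃ := Derives.all_elim (T := T) _ _ _ ha h₂
  rw [h₁] at h₃
  refine .mp (.thm (.mp (.all_imp v _ _ ?_) (.gen v h₃))) h
  rintro ⟨hne, hfree⟩
  have : ∀ φ : Formula, ¬ (φ.subst v (.var (v.withIdx k))).Free v := by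
    have hne' : v.withIdx k ≠ v := hne
    have ht : ∀ t : Term, ¬ (t.subst v (.var (v.withIdx k))).Occurs v := by
      intro t
      induction t with
      | var a => by_cases e : a = v <;> simp [Term.subst, e, Term.Occurs, hne']
      | empty => exact fun h => h
      | mat m n t ih => rintro ⟨i, j, h⟩; exact ih i j h
    intro φ
    induction φ with
    | falsum => exact fun h => h
    | eq s t => exact fun h => h.elim (ht s) (ht t)
    | mem s t => exact fun h => h.elim (ht s) (ht t)
    | imp φ ψ ih₁ ih₂ => exact fun h => h.elim ih₁ ih₂
    | all a φ ih =>
      by_cases e : a = v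
      · simp [Formula.subst, e, Formula.Free]
      · simp [Formula.subst, e, Formula.Free, ih]
  exact this φ hfree

end Prf

/-! ### The completeness theorem -/

/-- `Δ` is a maximal set of formulas consistent with `T`, and every universal formula that fails
according to `Δ` has a counterexample among the variables of arbitrarily large index. -/
structure Henkin (T Δ : Set Formula) : Prop where
  con : ¬ Prf T Δ falsum
  complete : ∀ φ, φ ∈ Δ ∨ φ.neg ∈ Δ
  witness : ∀ v φ, (all v φ).neg ∈ Δ →
    ∃ k, φ.bd ≤ k ∧ (φ.subst v (.var (v.withIdx k))).neg ∈ Δ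

/-- The step of the Henkin construction: `χ` or its negation is added, together with a
counterexample if `χ` is a refuted universal formula. Bounding the indices of the variables in the
set constructed so far leaves fresh variables for the counterexample, so that no new constants are
needed. -/
theorem exists_henkin_step {T Γ : Set Formula} (hc : ¬ Prf T Γ falsum)
    (hb : ∃ N, ∀ ψ ∈ Γ, ψ.bd ≤ N) (χ : Formula) :
    ∃ Γ', Γ ⊆ Γ' ∧ ¬ Prf T Γ' falsum ∧ (∃ N, ∀ ψ ∈ Γ', ψ.bd ≤ N) ∧ (χ ∈ Γ' ∨ χ.neg ∈ Γ') ∧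
      ∀ v φ, χ = all v φ → χ.neg ∈ Γ' →
        ∃ k, φ.bd ≤ k ∧ (φ.subst v (.var (v.withIdx k))).neg ∈ Γ' := by
  obtain ⟨N, hN⟩ := hb
  by_cases h₁ : Prf T (insert χ Γ) falsum
  · have h₂ : ¬ Prf T (insert χ.neg Γ) falsum := fun h => hc (.mp h₁.ded h.by_contra)
    have hb₂ : ∀ ψ ∈ insert χ.neg Γ, ψ.bd ≤ max N χ.bd := by
      rintro ψ (rfl | hψ)
      · simp [neg, Formula.bd]
      · exact le_max_of_le_left (hN ψ hψ)
    by_cases hall : ∃ v φ, χ = all v φ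
    · obtain ⟨v, φ, rfl⟩ := hall
      set k := max N (all v φ).bd
      have hφ : φ.bd ≤ k := le_max_of_le_right (le_max_right _ _)
      refine ⟨insert (φ.subst v (.var (v.withIdx k))).neg (insert (all v φ).neg Γ),
        fun ψ hψ => .inr (.inr hψ), fun h => ?_,
        ⟨max (φ.subst v (.var (v.withIdx k))).neg.bd k, ?_⟩, .inr (.inr (.inl rfl)), ?_⟩
      · have h₃ := h.by_contra.gen (v := v.withIdx k) fun ψ hψ =>
          Formula.not_free (by simpa using hb₂ ψ hψ)
        exact h₂ (.mp (.hyp (.inl rfl)) (h₃.all_of_all_fresh rfl hφ))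
      · rintro ψ (rfl | hψ)
        · exact le_max_left _ _
        · exact le_max_of_le_right (hb₂ ψ hψ)
      · rintro v' φ' h -
        cases h
        exact ⟨k, hφ, .inl rfl⟩
    · exact ⟨insert χ.neg Γ, Set.subset_insert _ _, h₂, ⟨_, hb₂⟩, .inr (.inl rfl),
        fun v φ h => absurd ⟨v, φ, h⟩ hall⟩
  · refine ⟨insert χ Γ, Set.subset_insert _ _, h₁, ⟨max N χ.bd, ?_⟩, .inl (.inl rfl),
      fun v φ _ h' => absurd (Prf.mp (.hyp h') (.hyp (.inl rfl))) h₁⟩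
    rintro ψ (rfl | hψ)
    · exact le_max_right _ _
    · exact le_max_of_le_left (hN ψ hψ)

/-- Lindenbaum's lemma with Henkin witnesses. -/
theorem exists_henkin {T : Set Formula} (hT : Consistent T) : ∃ Δ, Henkin T Δ := by
  classical
  have : Nonempty Formula := ⟨falsum⟩
  obtain ⟨enum, henum⟩ := exists_surjective_nat Formula
  let P := {Γ : Set Formula // ¬ Prf T Γ falsum ∧ ∃ N, ∀ ψ ∈ Γ, ψ.bd ≤ N}
  choose step hs₁ hs₂ hs₃ hs₄ hs₅ using fun (Γ : P) (χ : Formula) =>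
    exists_henkin_step Γ.2.1 Γ.2.2 χ
  let G : ℕ → P := fun n => Nat.rec ⟨∅, fun h => hT h.derives, 0, fun ψ h => h.elim⟩
    (fun n Γ => ⟨step Γ (enum n), hs₂ _ _, hs₃ _ _⟩) n
  have hmono : Monotone fun n => (G n).1 := monotone_nat_of_le_succ fun n => hs₁ (G n) (enum n)
  have hfin : ∀ φ, Prf T (⋃ n, (G n).1) φ → ∃ n, Prf T (G n).1 φ := by
    intro φ h
    induction h with
    | hyp h => obtain ⟨n, h⟩ := Set.mem_iUnion.1 h; exact ⟨n, .hyp h⟩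
    | thm h => exact ⟨0, .thm h⟩
    | mp _ _ ih₁ ih₂ =>
      obtain ⟨m, h₁⟩ := ih₁
      obtain ⟨n, h₂⟩ := ih₂
      exact ⟨max m n, .mp (h₁.mono (hmono (le_max_left _ _))) (h₂.mono (hmono (le_max_right _ _)))⟩
  have hcon : ¬ Prf T (⋃ n, (G n).1) falsum := fun h => by
    obtain ⟨n, h⟩ := hfin _ h
    exact (G n).2.1 h
  have hcomp : ∀ n, enum n ∈ (G (n + 1)).1 ∨ (enum n).neg ∈ (G (n + 1)).1 :=
    fun n => hs₄ (G n) (enum n)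
  refine ⟨⋃ n, (G n).1, hcon, fun φ => ?_, fun v φ h => ?_⟩
  · obtain ⟨n, rfl⟩ := henum φ
    exact (hcomp n).imp (fun h => Set.mem_iUnion.2 ⟨n + 1, h⟩) fun h => Set.mem_iUnion.2 ⟨n + 1, h⟩
  · obtain ⟨n, hn⟩ := henum (all v φ)
    have h' : (enum n).neg ∈ (G (n + 1)).1 := (hcomp n).resolve_left fun h' =>
      hcon (.mp (.hyp h) (.hyp (Set.mem_iUnion.2 ⟨n + 1, hn ▸ h'⟩)))
    obtain ⟨k, hk, hk'⟩ := hs₅ (G n) (enum n) v φ hn h'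
    exact ⟨k, hk, Set.mem_iUnion.2 ⟨n + 1, hk'⟩⟩

namespace Henkin

variable {T Δ : Set Formula} {φ ψ : Formula}

theorem mem_of_prf (H : Henkin T Δ) (h : Prf T Δ φ) : φ ∈ Δ :=
  (H.complete φ).resolve_right fun h' => H.con (.mp (.hyp h') h)

theorem mp (H : Henkin T Δ) (h : φ.imp ψ ∈ Δ) (h' : φ ∈ Δ) : ψ ∈ Δ :=
  H.mem_of_prf (.mp (.hyp h) (.hyp h'))

theorem thm (H : Henkin T Δ) (h : Derives T φ) : φ ∈ Δ := H.mem_of_prf (.thm h)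

theorem neg_mem (H : Henkin T Δ) : φ.neg ∈ Δ ↔ φ ∉ Δ :=
  ⟨fun h h' => H.con (.mp (.hyp h) (.hyp h')), fun h => (H.complete φ).resolve_left h⟩

theorem imp_mem (H : Henkin T Δ) : φ.imp ψ ∈ Δ ↔ (φ ∈ Δ → ψ ∈ Δ) := by
  refine ⟨H.mp, fun h => ?_⟩
  by_cases h' : φ ∈ Δ
  · exact H.mp (H.thm (.imp_k _ _)) (h h')
  · refine H.mem_of_prf (Prf.ded (Prf.by_contra ?_))
    exact .mp (.hyp (.inr (.inr (H.neg_mem.2 h')))) (.hyp (.inr (.inl rfl)))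

theorem all_mem (H : Henkin T Δ) {v : Var} : all v φ ∈ Δ ↔
    ∀ k, φ.bd ≤ k → φ.subst v (.var (v.withIdx k)) ∈ Δ := by
  constructor
  · exact fun h k hk => H.mem_of_prf (.all_elim v _ (admissible_withIdx v k)
      (Formula.freeFor_fresh (by simpa using hk) v) (.hyp h))
  · intro h
    by_contra h'
    obtain ⟨k, hk, hk'⟩ := H.witness v φ (H.neg_mem.2 h')
    exact H.neg_mem.1 hk' (h k hk)

/-- Every term is named by variables of arbitrarily large index: the bound variable in
`∃ w, t = w` may be chosen with a large index, and the witness is larger still. -/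
theorem exists_name (H : Henkin T Δ) {t : Term} {v : Var} (ht : Admissible t v) (K : ℕ) :
    ∃ k, K ≤ k ∧ .eq t (.var (v.withIdx k)) ∈ Δ := by
  set w := v.withIdx (max K t.bd) with hw
  have hto : ¬ t.Occurs w := Term.not_occurs (by simp [hw])
  have h : all w (Formula.eq t (.var w)).neg ∉ Δ := by
    intro h
    have h₁ := H.mem_of_prf (.all_elim w t ((admissible_withIdx_iff _).2 ht)
      (φ := (Formula.eq t (.var w)).neg) ⟨trivial, trivial⟩ (.hyp h))
    simp only [neg, Formula.subst, Term.subst, if_true, Term.subst_of_not_occurs hto] at h₁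
    exact H.neg_mem.1 h₁ (H.thm (.eq_refl t))
  obtain ⟨k, hk, hk'⟩ := H.witness _ _ (H.neg_mem.2 h)
  have hwi : w.idx + 1 ≤ k := le_trans (by simp [neg, Formula.bd, Term.bd]) hk
  refine ⟨k, ?_, ?_⟩
  · have : K ≤ w.idx := by simp [hw]
    omega
  · simp only [neg, Formula.subst, Term.subst, if_true, Term.subst_of_not_occurs hto] at hk'
    have h := H.mp (H.thm (.dne _)) hk'
    rwa [hw, Var.withIdx_withIdx] at h

/-- Leibniz's law, for a formula in which the place of substitution is marked by `greek i`. -/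
theorem eq_subst (H : Henkin T Δ) {s t : Term} (h : .eq s t ∈ Δ) (i : ℕ) (φ : Formula)
    (hs : φ.FreeFor s (.greek i)) (ht : φ.FreeFor t (.greek i))
    (h' : φ.subst (.greek i) s ∈ Δ) : φ.subst (.greek i) t ∈ Δ :=
  H.mp (H.mp (H.thm (.eq_subst i s t φ hs ht)) h) h'

theorem eq_symm (H : Henkin T Δ) {s t : Term} (h : .eq s t ∈ Δ) : .eq t s ∈ Δ := by
  have hs : ¬ s.Occurs (.greek s.bd) := Term.not_occurs le_rfl
  have := H.eq_subst h s.bd (.eq (.var (.greek s.bd)) s) trivial trivial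
  simp only [Formula.subst, Term.subst, if_true, Term.subst_of_not_occurs hs] at this
  exact this (H.thm (.eq_refl s))

theorem eq_trans (H : Henkin T Δ) {s t r : Term} (h : .eq s t ∈ Δ) (h' : .eq t r ∈ Δ) :
    .eq s r ∈ Δ := by
  have hs : ¬ s.Occurs (.greek s.bd) := Term.not_occurs le_rfl
  have := H.eq_subst h' s.bd (.eq s (.var (.greek s.bd))) trivial trivial
  simp only [Formula.subst, Term.subst, if_true, Term.subst_of_not_occurs hs] at this
  exact this h

theorem mem_congr (H : Henkin T Δ) {s t s' t' : Term} (h : .eq s s' ∈ Δ) (h' : .eq t t' ∈ Δ)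
    (hm : .mem s t ∈ Δ) : .mem s' t' ∈ Δ := by
  have ht : ¬ t.Occurs (.greek t.bd) := Term.not_occurs le_rfl
  have hs : ¬ s'.Occurs (.greek s'.bd) := Term.not_occurs le_rfl
  have h₁ := H.eq_subst h t.bd (.mem (.var (.greek t.bd)) t) trivial trivial
  simp only [Formula.subst, Term.subst, if_true, Term.subst_of_not_occurs ht] at h₁
  have h₂ := H.eq_subst h' s'.bd (.mem s' (.var (.greek s'.bd))) trivial trivial
  simp only [Formula.subst, Term.subst, if_true, Term.subst_of_not_occurs hs] at h₂
  exact h₂ (h₁ hm)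

theorem mat_congr (H : Henkin T Δ) {m n : ℕ+} {s t : Fin m → Fin n → Term}
    (h : ∀ i j, .eq (s i j) (t i j) ∈ Δ) : .eq (.mat m n s) (.mat m n t) ∈ Δ := by
  classical
  -- The entries are replaced one at a time.
  let mix (F : Finset (Fin m × Fin n)) : Fin m → Fin n → Term :=
    fun i j => if (i, j) ∈ F then t i j else s i j
  have key : ∀ F, .eq (.mat m n s) (.mat m n (mix F)) ∈ Δ := by
    intro F
    induction F using Finset.induction_on with
    | empty => simpa [mix] using H.thm (.eq_refl (.mat m n s))
    | insert p F hp ih =>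
      set K := max (Term.mat m n s).bd (Term.mat m n t).bd
      have hso : ∀ i j, ¬ (s i j).Occurs (.greek K) := fun i j =>
        Term.not_occurs ((Term.bd_entry_le s i j).trans (le_max_left _ _))
      have hto : ∀ i j, ¬ (t i j).Occurs (.greek K) := fun i j =>
        Term.not_occurs ((Term.bd_entry_le t i j).trans (le_max_right _ _))
      have hs : ¬ (Term.mat m n s).Occurs (.greek K) := Term.not_occurs (le_max_left _ _)
      let M : Fin m → Fin n → Term := fun i j => if (i, j) = p then .var (.greek K) else mix F i j
      have hM : ∀ r, (Formula.eq (.mat m n s) (.mat m n M)).subst (.greek K) r =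
          .eq (.mat m n s) (.mat m n fun i j => if (i, j) = p then r else mix F i j) := by
        intro r
        rw [Formula.subst, Term.subst_of_not_occurs hs, Term.subst]
        congr 2
        funext i j
        by_cases e : (i, j) = p
        · simp [M, e, Term.subst]
        · by_cases e' : (i, j) ∈ F <;>
            simp [M, mix, e, e', Term.subst_of_not_occurs (hso i j),
              Term.subst_of_not_occurs (hto i j)]
      have h₁ := H.eq_subst (h p.1 p.2) K (.eq (.mat m n s) (.mat m n M)) trivial trivial
      rw [hM, hM] at h₁
      convert h₁ ?_ using 3
      · funext i j
        by_cases e : (i, j) = p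
        · subst e; simp [mix]
        · simp [mix, e]
      · convert ih using 3
        funext i j
        by_cases e : (i, j) = p
        · subst e; simp [mix, hp]
        · simp [e]
  simpa [mix] using key Finset.univ

/-- Terms are identified when `Δ` says that they are equal. -/
def setoid (H : Henkin T Δ) : Setoid Term where
  r s t := .eq s t ∈ Δ
  iseqv := ⟨fun t => H.thm (.eq_refl t), H.eq_symm, H.eq_trans⟩

/-- The class of a term in the term model. -/
def cls (H : Henkin T Δ) (t : Term) : Quotient H.setoid := Quotient.mk H.setoid t

theorem cls_eq_iff (H : Henkin T Δ) {s t : Term} : H.cls s = H.cls t ↔ .eq s t ∈ Δ :=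
  Quotient.eq (r := H.setoid)

theorem cls_out (H : Henkin T Δ) (q : Quotient H.setoid) : H.cls q.out = q := Quotient.out_eq q

/-- The term model; the sets are the classes of the Roman variables. -/
noncomputable def model (H : Henkin T Δ) : Str where
  D := Quotient H.setoid
  S d := ∃ i, d = H.cls (.var (.roman i))
  f m n a := H.cls (.mat m n fun i j => (a i j).out)
  e := H.cls .empty
  mem a b := .mem a.out b.out ∈ Δ

/-- The assignment of its own class to each variable. -/
def idAssign (H : Henkin T Δ) (v : Var) : H.model.D := H.cls (.var v)

theorem eval_idAssign (H : Henkin T Δ) (t : Term) : H.model.eval H.idAssign t = H.cls t := by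
  induction t with
  | var v => rfl
  | empty => rfl
  | mat m n t ih =>
    refine H.cls_eq_iff.2 (H.mat_congr fun i j => ?_)
    exact H.cls_eq_iff.1 ((H.cls_out _).trans (ih i j))

theorem exists_name_of_ok (H : Henkin T Δ) {v : Var} {d : H.model.D} (hd : H.model.Ok v d)
    (K : ℕ) : ∃ k, K ≤ k ∧ d = H.idAssign (v.withIdx k) := by
  have : ∃ t, Admissible t v ∧ d = H.cls t := by
    cases v with
    | roman i => obtain ⟨j, h⟩ := hd; exact ⟨_, ⟨j, rfl⟩, h⟩
    | greek i => exact ⟨d.out, trivial, (H.cls_out d).symm⟩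
  obtain ⟨t, ht, rfl⟩ := this
  obtain ⟨k, hk, h⟩ := H.exists_name ht K
  exact ⟨k, hk, H.cls_eq_iff.2 h⟩

theorem good_idAssign (H : Henkin T Δ) : H.model.Good H.idAssign := by
  rintro (i | i)
  · exact ⟨i, rfl⟩
  · trivial

/-- The truth lemma. At a quantifier, every element is represented by a variable that does not
occur in the formula, so that only substitutions of fresh variables are needed. -/
theorem truth (H : Henkin T Δ) (φ : Formula) : H.model.sat φ H.idAssign ↔ φ ∈ Δ := by
  induction hn : φ.depth using Nat.strong_induction_on generalizing φ with
  | _ n ih =>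
    subst hn
    cases φ with
    | falsum => exact ⟨False.elim, fun h => H.con (.hyp h)⟩
    | eq s t =>
      rw [Str.sat_eq, H.eval_idAssign, H.eval_idAssign]
      exact H.cls_eq_iff
    | mem s t =>
      rw [Str.sat_mem, H.eval_idAssign, H.eval_idAssign]
      have h : ∀ t : Term, .eq (H.cls t).out t ∈ Δ := fun t => H.cls_eq_iff.1 (H.cls_out _)
      exact ⟨H.mem_congr (h s) (h t), H.mem_congr (H.eq_symm (h s)) (H.eq_symm (h t))⟩
    | imp φ ψ =>
      rw [Str.sat_imp, H.imp_mem,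
        ih _ (Nat.lt_succ_of_le (le_max_left φ.depth ψ.depth)) φ rfl,
        ih _ (Nat.lt_succ_of_le (le_max_right φ.depth ψ.depth)) ψ rfl]
    | all v φ =>
      have key : ∀ k, φ.bd ≤ k →
          (H.model.sat φ (Function.update H.idAssign v (H.idAssign (v.withIdx k))) ↔
            φ.subst v (.var (v.withIdx k)) ∈ Δ) := by
        intro k hk
        rw [← ih _ (Nat.lt_succ_self φ.depth) _ (Formula.depth_subst φ v _),
          Str.sat_subst (Formula.freeFor_fresh (by simpa using hk) v)]
        rfl
      rw [Str.sat_all, H.all_mem]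
      constructor
      · refine fun h k hk => (key k hk).1 (h _ ?_)
        cases v with
        | roman i => exact ⟨k, rfl⟩
        | greek i => trivial
      · intro h d hd
        obtain ⟨k, hk, rfl⟩ := H.exists_name_of_ok hd φ.bd
        exact (key k hk).2 (h k hk)

end Henkin

theorem Derives.alls {T : Set Formula} {φ : Formula} (h : Derives T φ) (l : List Var) :
    Derives T (alls l φ) := by
  induction l with
  | nil => exact h
  | cons v l ih => exact .gen v ih

theorem Str.sat_of_alls {M : Str} {φ : Formula} (l : List Var) {σ ρ : Var → M.D}
    (h : M.sat (alls l φ) ρ) (hσ : M.Good σ) (hl : ∀ v, v ∉ l → φ.Free v → σ v = ρ v) :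
    M.sat φ σ := by
  induction l generalizing ρ with
  | nil => exact (sat_congr fun v hv => hl v (by simp) hv).2 h
  | cons w l ih =>
    refine ih (h (σ w) (hσ w)) fun v hv hf => ?_
    by_cases e : v = w
    · subst e; simp
    · rw [Function.update_of_ne e]
      exact hl v (by simp [e, hv]) hf

/-- The completeness theorem: a consistent theory has a model. -/
theorem exists_model {T : Set Formula} (hT : Consistent T) :
    ∃ (M : Str) (σ : Var → M.D), M.Models T ∧ M.Good σ := by
  obtain ⟨Δ, H⟩ := exists_henkin hT
  refine ⟨H.model, H.idAssign, fun φ hφ σ hσ => ?_, H.good_idAssign⟩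
  -- The truth lemma concerns one assignment only; it is applied to the universal closure of `φ`.
  let l := (List.range φ.bd).map Var.roman ++ (List.range φ.bd).map Var.greek
  refine Str.sat_of_alls l ((H.truth _).2 (H.thm ((Derives.ax hφ).alls l))) hσ fun v hv hf => ?_
  refine absurd ?_ hv
  have := hf.lt_bd
  cases v <;> simpa [l, Var.idx] using this

/-! ### The semantic content of the axioms -/

namespace Str

variable {M : Str} {σ : Var → M.D} {φ : Formula}

/-- The assignment `σ`, except that `greek (c + i)` is sent to `b i` for `i < k`. -/
def setBlock (σ : Var → M.D) (c k : ℕ) (b : ℕ → M.D) : Var → M.D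
  | .roman i => σ (.roman i)
  | .greek i => if c ≤ i ∧ i < c + k then b (i - c) else σ (.greek i)

@[simp] theorem setBlock_roman (c k : ℕ) (b : ℕ → M.D) (i : ℕ) :
    setBlock σ c k b (.roman i) = σ (.roman i) := rfl

theorem setBlock_greek (c k : ℕ) (b : ℕ → M.D) {i : ℕ} (h : i < k) :
    setBlock σ c k b (.greek (c + i)) = b i := by
  simp [setBlock, h]

theorem setBlock_greek_of_not (c k : ℕ) (b : ℕ → M.D) {i : ℕ} (h : ¬ (c ≤ i ∧ i < c + k)) :
    setBlock σ c k b (.greek i) = σ (.greek i) := if_neg h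

theorem setBlock_zero (c : ℕ) (b : ℕ → M.D) : setBlock σ c 0 b = σ := by
  funext v
  cases v with
  | roman i => rfl
  | greek i => exact if_neg (by omega)

theorem update_setBlock (c k : ℕ) (b : ℕ → M.D) (d : M.D) :
    Function.update (setBlock σ c k b) (.greek (c + k)) d =
      setBlock σ c (k + 1) (Function.update b k d) := by
  funext v
  cases v with
  | roman i => simp
  | greek i =>
    by_cases h : i = c + k
    · subst h
      simp [setBlock]
    · have h₁ : (c ≤ i ∧ i < c + (k + 1)) ↔ (c ≤ i ∧ i < c + k) := by omega
      rw [Function.update_of_ne (by simpa using h)]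
      simp only [setBlock, h₁]
      split_ifs with h₂
      · rw [Function.update_of_ne (by omega)]
      · rfl

theorem block_succ (c k : ℕ) : block c (k + 1) = block c k ++ [.greek (c + k)] := by
  simp [block, List.range_succ]

theorem sat_alls_block (c k : ℕ) :
    M.sat (alls (block c k) φ) σ ↔ ∀ b, M.sat φ (setBlock σ c k b) := by
  induction k generalizing φ with
  | zero =>
    simp only [setBlock_zero]
    exact ⟨fun h _ => h, fun h => h fun _ => M.e⟩
  | succ k ih =>
    have : alls (block c (k + 1)) φ = alls (block c k) (all (.greek (c + k)) φ) := by
      rw [block_succ, alls, List.foldr_append]; rfl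
    rw [this, ih]
    simp only [sat_all, ok_greek, true_imp_iff, update_setBlock]
    refine ⟨fun h b => ?_, fun h b d => h _⟩
    simpa using h b (b k)

theorem sat_exs_block (c k : ℕ) :
    M.sat (exs (block c k) φ) σ ↔ ∃ b, M.sat φ (setBlock σ c k b) := by
  induction k generalizing φ with
  | zero =>
    simp only [setBlock_zero]
    exact ⟨fun h => ⟨fun _ => M.e, h⟩, fun ⟨_, h⟩ => h⟩
  | succ k ih =>
    have : exs (block c (k + 1)) φ = exs (block c k) (ex (.greek (c + k)) φ) := by
      rw [block_succ, exs, List.foldr_append]; rfl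
    rw [this, ih]
    simp only [sat_ex, ok_greek, true_and, update_setBlock]
    exact ⟨fun ⟨b, d, h⟩ => ⟨_, h⟩, fun ⟨b, h⟩ => ⟨b, b k, by simpa using h⟩⟩

/-- The `m × n` matrix whose entries, row by row, are `b 0, b 1, …`. -/
def ent {D : Type} (b : ℕ → D) (m n : ℕ+) : Fin m → Fin n → D := fun i j => b (n * i + j)

theorem ent_lt {m n : ℕ+} (i : Fin m) (j : Fin n) : (n : ℕ) * i + j < m * n := by
  calc (n : ℕ) * i + j < n * i + n := Nat.add_lt_add_left j.2 _
    _ = n * (i + 1) := by ring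
    _ ≤ n * m := Nat.mul_le_mul_left _ i.2
    _ = m * n := Nat.mul_comm _ _

theorem ent_div_mod {D : Type} (b : ℕ → D) {m n : ℕ+} {k : ℕ} (h : k < m * n) :
    b k = ent b m n ⟨k / n, Nat.div_lt_of_lt_mul (by rwa [Nat.mul_comm])⟩
      ⟨k % n, Nat.mod_lt _ n.pos⟩ := by
  simp [ent, Nat.div_add_mod]

theorem exists_ent {D : Type} {m n : ℕ+} (a : Fin m → Fin n → D) : ∃ b, ent b m n = a := by
  refine ⟨fun k => a ⟨k / n % m, Nat.mod_lt _ m.pos⟩ ⟨k % n, Nat.mod_lt _ n.pos⟩, ?_⟩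
  funext i j
  have h₁ : ((n : ℕ) * i + j) / n = i := by
    rw [Nat.mul_add_div n.pos, Nat.div_eq_of_lt j.2, Nat.add_zero]
  have h₂ : ((n : ℕ) * i + j) % n = j := by
    rw [Nat.mul_add_mod, Nat.mod_eq_of_lt j.2]
  simp only [ent, h₁, h₂, Nat.mod_eq_of_lt i.2]

theorem forall_ent {D : Type} {m n : ℕ+} {P : (Fin m → Fin n → D) → Prop} :
    (∀ b, P (ent b m n)) ↔ ∀ a, P a :=
  ⟨fun h a => by obtain ⟨b, rfl⟩ := exists_ent a; exact h b, fun h b => h _⟩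

theorem exists_ent_iff {D : Type} {m n : ℕ+} {P : (Fin m → Fin n → D) → Prop} :
    (∃ b, P (ent b m n)) ↔ ∃ a, P a :=
  ⟨fun ⟨b, h⟩ => ⟨_, h⟩, fun ⟨a, h⟩ => by obtain ⟨b, rfl⟩ := exists_ent a; exact ⟨b, h⟩⟩

theorem forall_lt_iff_forall_ent {D : Type} (b : ℕ → D) (m n : ℕ+) (P : D → Prop) :
    (∀ k < (m * n : ℕ), P (b k)) ↔ ∀ i j, P (ent b m n i j) :=
  ⟨fun h i j => h _ (ent_lt i j), fun h k hk => by rw [ent_div_mod b hk]; exact h _ _⟩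

theorem ent_eq_iff {D : Type} {b b' : ℕ → D} {m n : ℕ+} :
    ent b m n = ent b' m n ↔ ∀ k < (m * n : ℕ), b k = b' k :=
  ⟨fun h k hk => by rw [ent_div_mod b hk, ent_div_mod b' hk, h],
    fun h => funext fun i => funext fun j => h _ (ent_lt i j)⟩

theorem eval_matVars (c : ℕ) (m n : ℕ+) :
    M.eval σ (matVars c m n) = M.f m n (ent (fun k => σ (.greek (c + k))) m n) := rfl

theorem eval_matVars_setBlock (c : ℕ) (m n : ℕ+) (b : ℕ → M.D) :
    M.eval (setBlock σ c (m * n) b) (matVars c m n) = M.f m n (ent b m n) := by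
  rw [eval_matVars, ent_eq_iff.2 fun k hk => setBlock_greek c _ b hk]

theorem eval_matVars_setBlock_of_le {c k c' : ℕ} {m n : ℕ+} (h : c + m * n ≤ c') (b : ℕ → M.D) :
    M.eval (setBlock σ c' k b) (matVars c m n) = M.eval σ (matVars c m n) := by
  rw [eval_matVars, eval_matVars, ent_eq_iff.2 fun i hi => setBlock_greek_of_not c' _ b (by omega)]

theorem sat_divisionAxiomMatrices (m n p q : ℕ+) :
    M.sat (divisionAxiomMatrices m n p q) σ ↔ ∀ a b, M.f m n a ≠ M.f p q b := by
  simp only [divisionAxiomMatrices, sat_alls_block, sat_neg, sat_eq, eval_matVars_setBlock]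
  simp only [eval_matVars_setBlock_of_le (Nat.zero_add (m * n : ℕ)).le, eval_matVars_setBlock]
  rw [← forall_ent]
  exact forall_congr' fun b => forall_ent (P := fun a => M.f m n (ent b m n) ≠ M.f p q a)

theorem sat_matrixExtAxiom (m n : ℕ+) :
    M.sat (matrixExtAxiom m n) σ ↔ ∀ a b, M.f m n a = M.f m n b ↔ a = b := by
  simp only [matrixExtAxiom, sat_alls_block, sat_iff, sat_eq, eval_matVars_setBlock]
  simp only [eval_matVars_setBlock_of_le (Nat.zero_add (m * n : ℕ)).le, eval_matVars_setBlock]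
  rw [← forall_ent]
  refine forall_congr' fun b => ?_
  rw [← forall_ent]
  refine forall_congr' fun b' => ?_
  rw [ent_eq_iff, sat_conj]
  simp only [List.mem_map, List.mem_range, forall_exists_index, and_imp,
    forall_apply_eq_imp_iff₂, sat_eq, eval_var]
  refine iff_congr Iff.rfl (forall₂_congr fun k hk => ?_)
  rw [setBlock_greek _ _ _ hk, setBlock_greek_of_not _ _ _ (by omega)]
  have := setBlock_greek (σ := σ) 0 (m * n) b hk
  rw [Nat.zero_add] at this
  rw [this]

theorem sat_omissionAxiom (m n : ℕ+) :
    M.sat (omissionAxiom m n) σ ↔ ∀ a, M.f 1 1 (fun _ _ => M.f m n a) = M.f m n a := by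
  simp only [omissionAxiom, sat_alls_block, sat_eq, single, eval_mat, eval_matVars_setBlock]
  exact forall_ent (P := fun a => M.f 1 1 (fun _ _ => M.f m n a) = M.f m n a)

theorem sat_setMatrixAxiom (m n : ℕ+) : M.sat (setMatrixAxiom m n) σ := by
  simp only [setMatrixAxiom, sat_alls_block, sat_ex, sat_eq, eval_var, Function.update_self,
    ok_greek, true_and]
  refine fun b => ⟨M.eval (setBlock σ 1 (m * n) b) (matVars 1 m n), ?_⟩
  rw [eval_matVars, eval_matVars]
  congr 1
  refine ent_eq_iff.2 fun k _ => ?_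
  rw [Function.update_of_ne (by simp)]

theorem sat_divisionAxiomSets (m n : ℕ+) :
    M.sat (divisionAxiomSets m n) σ ↔ ∀ s, M.S s → ∀ a, s ≠ M.f m n a := by
  simp only [divisionAxiomSets, sat_alls_block, sat_neg, sat_eq, eval_matVars_setBlock, sat_all,
    eval_var, x, setBlock_roman, Function.update_self, ok_roman]
  exact forall₂_congr fun s _ => forall_ent (P := fun a => s ≠ M.f m n a)

theorem sat_epsilonAxiom (m n : ℕ+) :
    M.sat (epsilonAxiom m n) σ ↔ ∀ a d, ¬ M.mem d (M.f m n a) := by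
  rw [← forall_ent]
  simp only [epsilonAxiom, sat_alls_block, sat_neg, sat_mem, sat_all, ok_greek, true_imp_iff,
    eval_var, Function.update_self]
  refine forall₂_congr fun b d => ?_
  rw [eval_matVars, ent_eq_iff.2 fun k hk => ?_]
  rw [Function.update_of_ne (by simp), setBlock_greek _ _ _ hk]

theorem sat_reductionAxiom :
    M.sat reductionAxiom σ ↔ ∀ s, M.S s → M.f 1 1 (fun _ _ => s) = s := by
  simp only [reductionAxiom, single, x, sat_all, ok_roman, sat_eq, eval_mat, eval_var,
    Function.update_self]

theorem sat_setExtAxiom : M.sat setExtAxiom σ ↔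
    ∀ s, M.S s → ∀ t, M.S t → (s = t ↔ ∀ a, M.mem a s ↔ M.mem a t) := by
  simp [setExtAxiom, x, y, α]

theorem sat_emptyAxiom : M.sat emptyAxiom σ ↔ M.S M.e ∧ ∀ a, ¬ M.mem a M.e := by
  simp only [emptyAxiom, x, α, sat_ex, ok_roman, sat_and, sat_eq, eval_var, eval_empty, sat_all,
    ok_greek, sat_neg, sat_mem, true_imp_iff, Function.update_self, ne_eq, reduceCtorEq,
    not_false_eq_true, Function.update_of_ne]
  exact ⟨fun ⟨d, h, e, h'⟩ => e ▸ ⟨h, h'⟩, fun h => ⟨_, h.1, rfl, h.2⟩⟩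

theorem sat_pairAxiom : M.sat pairAxiom σ ↔
    ∀ a b, ∃ s, M.S s ∧ ∀ c, M.mem c s ↔ c = a ∨ c = b := by
  simp [pairAxiom, x, α, β, γ]

theorem sat_unionAxiom : M.sat unionAxiom σ ↔
    ∀ s, M.S s → (∀ a, M.mem a s → M.S a) →
      ∃ t, M.S t ∧ ∀ b, M.mem b t ↔ ∃ r, M.S r ∧ M.mem r s ∧ M.mem b r := by
  simp [unionAxiom, x, y, z, u, α, β]

theorem sat_powerAxiom : M.sat powerAxiom σ ↔
    ∀ s, M.S s → ∃ t, M.S t ∧ ∀ a, M.mem a t ↔ M.S a ∧ ∀ b, M.mem b a → M.mem b s := by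
  simp only [powerAxiom, x, y, u, α, β, sat_all, ok_roman, sat_ex, ok_greek, true_imp_iff, sat_iff,
    sat_mem, eval_var, sat_and, sat_eq, sat_imp]
  simp

theorem sat_infinityAxiom : M.sat infinityAxiom σ ↔
    ∃ s, M.S s ∧ M.mem M.e s ∧ ∀ a, M.S a → M.mem a s →
      ∃ t, M.S t ∧ M.mem t s ∧ ∀ c, M.mem c t ↔ c = a := by
  simp [infinityAxiom, singletonMem, x, y, z, γ]

theorem sat_regularityAxiom : M.sat regularityAxiom σ ↔
    ∀ s, M.S s → (∃ a, M.mem a s) → ∃ a, M.mem a s ∧ ∀ b, M.mem b a → ¬ M.mem b s := by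
  simp [regularityAxiom, x, α, β]

theorem sat_exs_matrix (m n : ℕ+) :
    M.sat (exs (block 1 (m * n)) ((Formula.eq α (matVars 1 m n)).and
      (conj ((List.range (m * n)).map fun k => Formula.mem (Var.greek (1 + k)) x)))) σ ↔
    ∃ b, σ α = M.f m n b ∧ ∀ i j, M.mem (b i j) (σ x) := by
  simp only [sat_exs_block, sat_and, sat_conj, sat_eq, eval_matVars_setBlock, List.mem_map,
    List.mem_range, forall_exists_index, and_imp, forall_apply_eq_imp_iff₂]
  rw [← exists_ent_iff]
  refine exists_congr fun b => and_congr ?_ ?_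
  · rw [α, eval_var, setBlock_greek_of_not _ _ _ (by omega)]
  · rw [← forall_lt_iff_forall_ent b m n fun d => M.mem d (σ x)]
    refine forall₂_congr fun k hk => ?_
    rw [sat_mem, eval_var, eval_var, setBlock_greek _ _ _ hk]
    rfl

theorem sat_setOfMatricesAxiom (m n : ℕ+) : M.sat (setOfMatricesAxiom m n) σ ↔
    ∀ s, M.S s → ∃ t, M.S t ∧
      ∀ a, M.mem a t ↔ ∃ b, a = M.f m n b ∧ ∀ i j, M.mem (b i j) s := by
  simp only [setOfMatricesAxiom, sat_all, sat_ex, sat_iff, sat_exs_matrix]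
  simp [x, y, α]

/-- The axioms of SMT⁻, except for the schemata of separation and replacement, with the logical
syntax stripped off. The axioms of reduction and omission amount to `[a] = a` for all objects `a`:
omission gives `[[a]] = [a]`, whence `[a] = a` by extensionality for `1 × 1` matrices. -/
structure Basic (M : Str) : Prop where
  f_one : ∀ a, M.f 1 1 (fun _ _ => a) = a
  f_inj : ∀ {m n a b}, M.f m n a = M.f m n b → a = b
  f_ne : ∀ {m n p q : ℕ+} {a b}, ((1, 1) : ℕ+ × ℕ+) ≠ (m, n) → (m, n) ≠ (p, q) →
    (p, q) ≠ (1, 1) → M.f m n a ≠ M.f p q b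
  ext : ∀ {s t}, M.S s → M.S t → (∀ a, M.mem a s ↔ M.mem a t) → s = t
  S_e : M.S M.e
  not_mem_e : ∀ a, ¬ M.mem a M.e
  pair : ∀ a b, ∃ s, M.S s ∧ ∀ c, M.mem c s ↔ c = a ∨ c = b
  union : ∀ s, M.S s → (∀ a, M.mem a s → M.S a) →
    ∃ t, M.S t ∧ ∀ b, M.mem b t ↔ ∃ r, M.S r ∧ M.mem r s ∧ M.mem b r
  power : ∀ s, M.S s → ∃ t, M.S t ∧ ∀ a, M.mem a t ↔ M.S a ∧ ∀ b, M.mem b a → M.mem b s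
  infinity : ∃ s, M.S s ∧ M.mem M.e s ∧ ∀ a, M.S a → M.mem a s →
    ∃ t, M.S t ∧ M.mem t s ∧ ∀ c, M.mem c t ↔ c = a
  mats : ∀ (m n : ℕ+) s, M.S s → ∃ t, M.S t ∧
    ∀ a, M.mem a t ↔ ∃ b, a = M.f m n b ∧ ∀ i j, M.mem (b i j) s

/-- Separation for the formulas of the language, with parameters. -/
def Separation (M : Str) : Prop :=
  ∀ (φ : Formula) (k : ℕ) (σ : Var → M.D), M.Good σ → ∀ s, M.S s →
    ∃ t, M.S t ∧ ∀ a, M.mem a t ↔ M.mem a s ∧ M.sat φ (Function.update σ (.greek k) a)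

/-- Replacement for the formulas of the language, with parameters. -/
def Replacement (M : Str) : Prop :=
  ∀ (φ : Formula) (k l : ℕ) (σ : Var → M.D), k ≠ l → M.Good σ → ∀ s, M.S s →
    (∀ a, M.mem a s → ∃ c, ∀ b,
      M.sat φ (Function.update (Function.update σ (.greek k) a) (.greek l) b) ↔ b = c) →
    ∃ t, M.S t ∧ ∀ b, M.mem b t ↔ ∃ a, M.mem a s ∧
      M.sat φ (Function.update (Function.update σ (.greek k) a) (.greek l) b)

/-- Separation without the syntactic side conditions: the bound Roman variables of the axiom are
chosen not to occur in `φ`. -/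
theorem separation_of_models (h : M.Models SMTminus) : M.Separation := by
  intro φ k σ hσ s hs
  set i := φ.bd with hi
  have hφi : ¬ φ.Free (.roman i) := Formula.not_free (by simp [Var.idx, hi])
  have hφj : ¬ φ.Free (.roman (i + 1)) := Formula.not_free (by simp [Var.idx, hi])
  have h₁ := h _ (.separation i (i + 1) k φ (by omega) hφj) σ hσ
  simp only [separationAxiom, sat_all, ok_roman, sat_ex, sat_iff, sat_and, sat_mem, eval_var,
    ok_greek, true_imp_iff] at h₁
  obtain ⟨t, ht, h₂⟩ := h₁ s hs
  refine ⟨t, ht, fun a => ?_⟩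
  have h₃ := h₂ a
  have e : M.sat φ (Function.update (Function.update (Function.update σ (.roman i) s)
      (.roman (i + 1)) t) (.greek k) a) ↔ M.sat φ (Function.update σ (.greek k) a) := by
    refine sat_congr fun v hv => ?_
    have h₁ : v ≠ .roman i := fun e => hφi (e ▸ hv)
    have h₂ : v ≠ .roman (i + 1) := fun e => hφj (e ▸ hv)
    simp [Function.update_apply, h₁, h₂]
  rw [e] at h₃
  simpa using h₃

theorem replacement_of_models (h : M.Models SMTminus) : M.Replacement := by
  intro φ k l σ hkl hσ s hs hf
  set i := φ.bd with hi
  set c := max φ.bd (l + 1) with hc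
  have hφi : ¬ φ.Free (.roman i) := Formula.not_free (by simp [Var.idx, hi])
  have hφj : ¬ φ.Free (.roman (i + 1)) := Formula.not_free (by simp [Var.idx, hi])
  have hφc : ¬ φ.Free (.greek c) := Formula.not_free (by simp [Var.idx, hc])
  have h₁ := h _ (.replacement i (i + 1) k l c φ (by omega) hkl (by omega) hφj hφc) σ hσ
  have hcl : c ≠ l := by omega
  simp only [replacementAxiom, sat_all, ok_roman, sat_ex, sat_iff, sat_and, sat_mem, eval_var,
    ok_greek, true_imp_iff, true_and, sat_imp, sat_eq] at h₁
  have h₂ := h₁ s hs ?_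
  · obtain ⟨t, ht, h₂⟩ := h₂
    refine ⟨t, ht, fun b => ?_⟩
    have h₃ := h₂ b
    have e : ∀ a, M.sat φ (Function.update (Function.update (Function.update (Function.update σ
        (.roman i) s) (.roman (i + 1)) t) (.greek l) b) (.greek k) a) ↔
        M.sat φ (Function.update (Function.update σ (.greek k) a) (.greek l) b) := by
      intro a
      refine sat_congr fun v hv => ?_
      have h₁ : v ≠ .roman i := fun e => hφi (e ▸ hv)
      have h₂ : v ≠ .roman (i + 1) := fun e => hφj (e ▸ hv)
      by_cases h₃ : v = .greek k
      · subst h₃; simp [hkl]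
      · by_cases h₄ : v = .greek l
        · subst h₄; simp [h₃]
        · simp [h₁, h₂, h₃, h₄]
    simp only [e] at h₃
    simpa using h₃
  · intro a ha
    obtain ⟨d, hd⟩ := hf a (by simpa using ha)
    refine ⟨d, fun b => ?_⟩
    rw [Function.update_of_ne (a := Var.greek c) (by simpa using hcl), Function.update_self,
      Function.update_self, ← hd b]
    refine sat_congr fun v hv => ?_
    have h₁ : v ≠ .roman i := fun e => hφi (e ▸ hv)
    have h₂ : v ≠ .greek c := fun e => hφc (e ▸ hv)
    simp [Function.update_apply, h₁, h₂]

theorem basic_of_models (h : M.Models SMTminus) (hσ : M.Good σ) : M.Basic := by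
  have hinj : ∀ {m n a b}, M.f m n a = M.f m n b → a = b := fun {m n a b} e =>
    ((sat_matrixExtAxiom m n).1 (h _ (.matrixExt m n) σ hσ) a b).1 e
  have hone : ∀ a, M.f 1 1 (fun _ _ => a) = a := fun a => congrFun (congrFun
    (hinj ((sat_omissionAxiom 1 1).1 (h _ (.omission 1 1) σ hσ) fun _ _ => a)) 0) 0
  have he := sat_emptyAxiom.1 (h _ .empty σ hσ)
  exact
  { f_one := hone
    f_inj := hinj
    f_ne := fun h₁ h₂ h₃ => (sat_divisionAxiomMatrices _ _ _ _).1
      (h _ (.divisionMatrices _ _ _ _ h₁ h₂ h₃) σ hσ) _ _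
    ext := fun hs ht h' => (sat_setExtAxiom.1 (h _ .setExt σ hσ) _ hs _ ht).2 h'
    S_e := he.1
    not_mem_e := he.2
    pair := sat_pairAxiom.1 (h _ .pair σ hσ)
    union := sat_unionAxiom.1 (h _ .union σ hσ)
    power := sat_powerAxiom.1 (h _ .power σ hσ)
    infinity := sat_infinityAxiom.1 (h _ .infinity σ hσ)
    mats := fun m n => (sat_setOfMatricesAxiom m n).1 (h _ (.setOfMatrices m n) σ hσ) }

theorem models_SMTminus (hB : M.Basic) (hS : M.Separation) (hR : M.Replacement) :
    M.Models SMTminus := by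
  intro φ hφ σ hσ
  cases hφ with
  | setMatrix m n => exact sat_setMatrixAxiom m n
  | reduction => exact sat_reductionAxiom.2 fun s _ => hB.f_one s
  | omission m n => exact (sat_omissionAxiom m n).2 fun a => hB.f_one _
  | divisionMatrices m n p q h₁ h₂ h₃ =>
    exact (sat_divisionAxiomMatrices m n p q).2 fun a b => hB.f_ne h₁ h₂ h₃
  | matrixExt m n =>
    exact (sat_matrixExtAxiom m n).2 fun a b => ⟨hB.f_inj, fun h => h ▸ rfl⟩
  | setExt => exact sat_setExtAxiom.2 fun s hs t ht => ⟨fun h _ => h ▸ Iff.rfl, hB.ext hs ht⟩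
  | empty => exact sat_emptyAxiom.2 ⟨hB.S_e, hB.not_mem_e⟩
  | separation i j a Φ hij hj =>
    simp only [separationAxiom, sat_all, ok_roman, sat_ex, sat_iff, sat_and, sat_mem, eval_var,
      ok_greek, true_imp_iff]
    intro s hs
    obtain ⟨t, ht, h⟩ := hS Φ a (Function.update σ (.roman i) s) (hσ.update hs) s hs
    refine ⟨t, ht, fun d => ?_⟩
    have e : M.sat Φ (Function.update (Function.update (Function.update σ (.roman i) s)
        (.roman j) t) (.greek a) d) ↔
        M.sat Φ (Function.update (Function.update σ (.roman i) s) (.greek a) d) := by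
      refine sat_congr fun v hv => ?_
      have h₁ : v ≠ .roman j := fun e => hj (e ▸ hv)
      simp [Function.update_apply, h₁]
    rw [e]
    simpa [hij] using h d
  | pair => exact sat_pairAxiom.2 hB.pair
  | union => exact sat_unionAxiom.2 hB.union
  | power => exact sat_powerAxiom.2 hB.power
  | infinity => exact sat_infinityAxiom.2 hB.infinity
  | replacement i j a b c Φ hij hab hcb hj hc =>
    simp only [replacementAxiom, sat_all, ok_roman, sat_ex, sat_iff, sat_and, sat_mem, eval_var,
      ok_greek, true_imp_iff, true_and, sat_imp, sat_eq]
    intro s hs hf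
    have h := hR Φ a b (Function.update σ (.roman i) s) hab (hσ.update hs) s hs ?_
    · obtain ⟨t, ht, h⟩ := h
      refine ⟨t, ht, fun d => ?_⟩
      have e : ∀ r, M.sat Φ (Function.update (Function.update (Function.update (Function.update σ
          (.roman i) s) (.roman j) t) (.greek b) d) (.greek a) r) ↔
          M.sat Φ (Function.update (Function.update (Function.update σ (.roman i) s)
            (.greek a) r) (.greek b) d) := by
        intro r
        refine sat_congr fun v hv => ?_
        have h₁ : v ≠ .roman j := fun e => hj (e ▸ hv)
        by_cases h₃ : v = .greek a
        · subst h₃; simp [hab]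
        · simp [Function.update_apply, h₁, h₃]
      simp only [e]
      simpa [hij] using h d
    · intro r hr
      obtain ⟨d, hd⟩ := hf r (by simpa using hr)
      refine ⟨d, fun d' => ?_⟩
      have := hd d'
      rw [Function.update_of_ne (a := Var.greek c) (by simpa using hcb), Function.update_self,
        Function.update_self] at this
      rw [← this]
      refine sat_congr fun v hv => ?_
      have h₂ : v ≠ .greek c := fun e => hc (e ▸ hv)
      simp [Function.update_apply, h₂]
  | setOfMatrices m n => exact (sat_setOfMatricesAxiom m n).2 (hB.mats m n)

end Str

/-! ### Coding sets by matrices -/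

/-- The term `[t t]`. -/
def twoT (t : Term) : Term := .mat 1 2 fun _ _ => t

/-- The term `[t t t]`. -/
def threeT (t : Term) : Term := .mat 1 3 fun _ _ => t

namespace Str

/-- The matrix `[d d]`. -/
def two (M : Str) (d : M.D) : M.D := M.f 1 2 fun _ _ => d

/-- The matrix `[d d d]`. -/
def three (M : Str) (d : M.D) : M.D := M.f 1 3 fun _ _ => d

/-- The matrix `y` is the code of the set `s`: the code of `∅` is `[∅ ∅]`, the code of
`{[z z]}` is `[{z} {z}]` if `z` is a set, and the code of any other set `s` is `[s s s]`. The two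
special cases make the codes of the Zermelo numerals of the coded sets equal to the `[z z]`, with
`z` a Zermelo numeral, so that the axiom of infinity is inherited without a recursion. -/
def Code (M : Str) (s y : M.D) : Prop :=
  M.S s ∧ (((∀ a, ¬ M.mem a s) ∧ y = M.two s) ∨
    (∃ r, M.S r ∧ ∃ t, M.S t ∧ (∀ a, M.mem a s ↔ a = M.two r) ∧ (∀ a, M.mem a t ↔ a = r) ∧
      y = M.two t) ∨
    (¬ (∀ a, ¬ M.mem a s) ∧ ¬ (∃ r, M.S r ∧ ∀ a, M.mem a s ↔ a = M.two r) ∧ y = M.three s))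

/-- `y` is the code of a set. -/
def IsCode (M : Str) (y : M.D) : Prop := ∃ s, M.Code s y

/-- `a` is an element of the set coded by `y`. -/
def CodeMem (M : Str) (a y : M.D) : Prop := ∃ s, M.Code s y ∧ M.mem a s

/-- `a` is well-founded for the membership relation of codes: every set that contains `a` has a
minimal element. -/
def WF (M : Str) (a : M.D) : Prop :=
  ∀ s, M.S s → M.mem a s → ∃ g, M.mem g s ∧ ∀ d, M.CodeMem d g → ¬ M.mem d s

/-- The matrix `a`, extended by a row of `∅`s unless it is `1 × 1`. As the result has at least two
rows, it is not the code of a set. -/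
def pad (M : Str) (m n : ℕ+) (a : Fin m → Fin n → M.D) : M.D :=
  if m = 1 ∧ n = 1 then a ⟨0, m.pos⟩ ⟨0, n.pos⟩
  else M.f (m + 1) n fun i j => if h : (i : ℕ) < m then a ⟨i, h⟩ j else M.e

variable {M : Str}

namespace Basic

theorem two_inj (hB : M.Basic) {a b : M.D} (h : M.two a = M.two b) : a = b :=
  congrFun (congrFun (hB.f_inj h) 0) 0

theorem three_inj (hB : M.Basic) {a b : M.D} (h : M.three a = M.three b) : a = b :=
  congrFun (congrFun (hB.f_inj h) 0) 0

theorem two_ne_three (hB : M.Basic) (a b : M.D) : M.two a ≠ M.three b :=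
  hB.f_ne (by decide) (by decide) (by decide)

theorem exists_singleton (hB : M.Basic) (a : M.D) : ∃ s, M.S s ∧ ∀ b, M.mem b s ↔ b = a := by
  obtain ⟨s, hs, h⟩ := hB.pair a a
  exact ⟨s, hs, fun b => by rw [h, or_self]⟩

theorem exists_insert (hB : M.Basic) {s : M.D} (hs : M.S s) (a : M.D) :
    ∃ t, M.S t ∧ ∀ b, M.mem b t ↔ M.mem b s ∨ b = a := by
  obtain ⟨p, hp, hp'⟩ := hB.exists_singleton a
  obtain ⟨q, hq, hq'⟩ := hB.pair s p
  obtain ⟨t, ht, h⟩ := hB.union q hq fun b hb => by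
    rcases (hq' b).1 hb with rfl | rfl
    exacts [hs, hp]
  refine ⟨t, ht, fun b => (h b).trans ⟨?_, ?_⟩⟩
  · rintro ⟨r, _, hr, hb⟩
    rcases (hq' r).1 hr with rfl | rfl
    exacts [.inl hb, .inr ((hp' b).1 hb)]
  · rintro (hb | rfl)
    · exact ⟨s, hs, (hq' s).2 (.inl rfl), hb⟩
    · exact ⟨p, hp, (hq' p).2 (.inr rfl), (hp' b).2 rfl⟩

theorem exists_code (hB : M.Basic) {s : M.D} (hs : M.S s) : ∃ y, M.Code s y := by
  by_cases h₁ : ∀ a, ¬ M.mem a s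
  · exact ⟨_, hs, .inl ⟨h₁, rfl⟩⟩
  by_cases h₂ : ∃ r, M.S r ∧ ∀ a, M.mem a s ↔ a = M.two r
  · obtain ⟨r, hr, h⟩ := h₂
    obtain ⟨t, ht, h'⟩ := hB.exists_singleton r
    exact ⟨_, hs, .inr (.inl ⟨r, hr, t, ht, h, h', rfl⟩)⟩
  · exact ⟨_, hs, .inr (.inr ⟨h₁, h₂, rfl⟩)⟩

theorem code_unique (hB : M.Basic) {s y y' : M.D} (h : M.Code s y) (h' : M.Code s y') :
    y = y' := by
  obtain ⟨hs, ⟨h₁, rfl⟩ | ⟨r, hr, t, ht, h₁, h₂, rfl⟩ | ⟨h₁, h₂, rfl⟩⟩ := h <;>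
    obtain ⟨-, ⟨h₁', rfl⟩ | ⟨r', hr', t', ht', h₁', h₂', rfl⟩ | ⟨h₁', h₂', rfl⟩⟩ := h'
  · rfl
  · exact absurd ((h₁' _).2 rfl) (h₁ _)
  · exact absurd h₁ h₁'
  · exact absurd ((h₁ _).2 rfl) (h₁' _)
  · have e : r = r' := hB.two_inj ((h₁' _).1 ((h₁ _).2 rfl))
    rw [hB.ext ht ht' fun a => by rw [h₂, h₂', e]]
  · exact absurd ⟨r, hr, h₁⟩ h₂'
  · exact absurd h₁' h₁
  · exact absurd ⟨r', hr', h₁'⟩ h₂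
  · rfl

theorem code_inj (hB : M.Basic) {s s' y : M.D} (h : M.Code s y) (h' : M.Code s' y) :
    s = s' := by
  obtain ⟨hs, ⟨h₁, e⟩ | ⟨r, hr, t, ht, h₁, h₂, e⟩ | ⟨h₁, h₂, e⟩⟩ := h <;>
    obtain ⟨hs', ⟨h₁', e'⟩ | ⟨r', hr', t', ht', h₁', h₂', e'⟩ | ⟨h₁', h₂', e'⟩⟩ := h' <;>
    rw [e] at e'
  · exact hB.two_inj e'
  · rw [hB.two_inj e'] at h₁
    exact absurd ((h₂' _).2 rfl) (h₁ _)
  · exact absurd e' (hB.two_ne_three _ _)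
  · rw [← hB.two_inj e'] at h₁'
    exact absurd ((h₂ _).2 rfl) (h₁' _)
  · have ht := hB.two_inj e'
    have hr : r = r' := (h₂' r).1 (ht ▸ (h₂ r).2 rfl)
    exact hB.ext hs hs' fun a => by rw [h₁, h₁', hr]
  · exact absurd e' (hB.two_ne_three _ _)
  · exact absurd e'.symm (hB.two_ne_three _ _)
  · exact absurd e'.symm (hB.two_ne_three _ _)
  · exact hB.three_inj e'

theorem codeMem_iff (hB : M.Basic) {s y : M.D} (h : M.Code s y) (a : M.D) :
    M.CodeMem a y ↔ M.mem a s :=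
  ⟨fun ⟨_, h₁, h₂⟩ => hB.code_inj h₁ h ▸ h₂, fun h' => ⟨s, h, h'⟩⟩

theorem code_empty (hB : M.Basic) : M.Code M.e (M.two M.e) :=
  ⟨hB.S_e, .inl ⟨hB.not_mem_e, rfl⟩⟩

theorem pad_of_ne {m n : ℕ+} (h : ((1, 1) : ℕ+ × ℕ+) ≠ (m, n)) (a : Fin m → Fin n → M.D) :
    M.pad m n a = M.f (m + 1) n fun i j => if h : (i : ℕ) < m then a ⟨i, h⟩ j else M.e :=
  if_neg fun e => h (by rw [e.1, e.2])

theorem one_one_ne {k n : ℕ+} : ((1, 1) : ℕ+ × ℕ+) ≠ (k + 1, n) := fun h =>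
  absurd (congrArg (fun p : ℕ+ × ℕ+ => (p.1 : ℕ)) h) (by simp)

theorem pad_inj (hB : M.Basic) {m n : ℕ+} {a b : Fin m → Fin n → M.D}
    (h : M.pad m n a = M.pad m n b) : a = b := by
  by_cases hmn : m = 1 ∧ n = 1
  · obtain ⟨rfl, rfl⟩ := hmn
    funext i j
    rw [Subsingleton.elim (α := Fin 1) i ⟨0, Nat.one_pos⟩,
      Subsingleton.elim (α := Fin 1) j ⟨0, Nat.one_pos⟩]
    exact h
  · have hne : ((1, 1) : ℕ+ × ℕ+) ≠ (m, n) := fun e =>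
      hmn ⟨(congrArg Prod.fst e).symm, (congrArg Prod.snd e).symm⟩
    rw [pad_of_ne hne, pad_of_ne hne] at h
    have h' := hB.f_inj h
    funext i j
    have hi : (i : ℕ) < (m + 1 : ℕ+) := by
      rw [PNat.add_coe]; exact i.2.trans (Nat.lt_succ_self _)
    simpa using congrFun (congrFun h' ⟨i, hi⟩) j

theorem pad_ne (hB : M.Basic) {m n p q : ℕ+} {a : Fin m → Fin n → M.D}
    {b : Fin p → Fin q → M.D} (h₁ : ((1, 1) : ℕ+ × ℕ+) ≠ (m, n)) (h₂ : (m, n) ≠ (p, q))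
    (h₃ : (p, q) ≠ ((1, 1) : ℕ+ × ℕ+)) : M.pad m n a ≠ M.pad p q b := by
  rw [pad_of_ne h₁, pad_of_ne h₃.symm]
  refine hB.f_ne one_one_ne (fun e => h₂ ?_) one_one_ne.symm
  have e₁ : m + 1 = p + 1 := congrArg Prod.fst e
  have e₂ : n = q := congrArg Prod.snd e
  rw [add_right_cancel e₁, e₂]

theorem not_isCode_pad (hB : M.Basic) {m n : ℕ+} (h : ((1, 1) : ℕ+ × ℕ+) ≠ (m, n))
    (a : Fin m → Fin n → M.D) : ¬ M.IsCode (M.pad m n a) := by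
  have key : ∀ (k : ℕ+) (b : Fin (1 : ℕ+) → Fin k → M.D), k ≠ 1 → M.pad m n a ≠ M.f 1 k b := by
    intro k b hk
    rw [pad_of_ne h]
    refine hB.f_ne one_one_ne (fun e => ?_) fun e => hk (congrArg Prod.snd e)
    exact absurd (congrArg (fun p : ℕ+ × ℕ+ => (p.1 : ℕ)) e) (by simp)
  rintro ⟨s, -, ⟨-, e⟩ | ⟨_, _, _, _, _, _, e⟩ | ⟨_, _, e⟩⟩
  · exact key 2 _ (by decide) e
  · exact key 2 _ (by decide) e
  · exact key 3 _ (by decide) e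

end Basic

/-- An object all of whose elements are well-founded is well-founded. -/
theorem wf_of_codeMem_wf {a : M.D} (h : ∀ b, M.CodeMem b a → M.WF b) : M.WF a := by
  intro s hs ha
  by_cases h' : ∃ b, M.CodeMem b a ∧ M.mem b s
  · obtain ⟨b, hb, hb'⟩ := h'
    exact h b hb s hs hb'
  · push Not at h'
    exact ⟨a, ha, h'⟩

namespace Basic

/-- The elements of a well-founded object are well-founded: a set `s` that contains the element
`b` of `a` has a minimal element, as `s ∪ {a}` has one, and it is not `a`. -/
theorem wf_of_codeMem (hB : M.Basic) {a b : M.D} (ha : M.WF a) (h : M.CodeMem b a) : M.WF b := by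
  intro s hs hb
  obtain ⟨t, ht, ht'⟩ := hB.exists_insert hs a
  obtain ⟨g, hg, hg'⟩ := ha t ht ((ht' a).2 (.inr rfl))
  rcases (ht' g).1 hg with hg | rfl
  · exact ⟨g, hg, fun d hd hd' => hg' d hd ((ht' d).2 (.inl hd'))⟩
  · exact absurd ((ht' b).2 (.inl hb)) (hg' b h)

theorem wf_pad (hB : M.Basic) {m n : ℕ+} {a : Fin m → Fin n → M.D} (ha : ∀ i j, M.WF (a i j)) :
    M.WF (M.pad m n a) := by
  by_cases h : ((1, 1) : ℕ+ × ℕ+) = (m, n)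
  · obtain ⟨rfl, rfl⟩ := Prod.mk.inj h
    exact ha _ _
  · exact wf_of_codeMem_wf fun b ⟨s, hs, _⟩ => absurd ⟨s, hs⟩ (hB.not_isCode_pad h a)

theorem wf_two_e (hB : M.Basic) : M.WF (M.two M.e) :=
  wf_of_codeMem_wf fun b hb => absurd ((hB.codeMem_iff hB.code_empty b).1 hb) (hB.not_mem_e b)

/-- The interpretation of set matrix theory in a structure `M`: the domain consists of the
well-founded elements of `M`, the sets are the codes of sets, and matrices are padded. -/
def interp (hB : M.Basic) : Str where
  D := {d // M.WF d}
  S d := M.IsCode d.1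
  f m n a := ⟨M.pad m n fun i j => (a i j).1, hB.wf_pad fun i j => (a i j).2⟩
  e := ⟨M.two M.e, hB.wf_two_e⟩
  mem a b := M.CodeMem a.1 b.1

end Basic

theorem Basic.interp_f_val (hB : M.Basic) {m n : ℕ+} (a : Fin m → Fin n → hB.interp.D) :
    (hB.interp.f m n a).1 = M.pad m n fun i j => (a i j).1 := rfl

theorem Basic.interp_ext_iff (hB : M.Basic) {a b : hB.interp.D} : a = b ↔ a.1 = b.1 :=
  Subtype.ext_iff

/-! ### Definability of the interpretation -/

/-- The set `v` is empty. -/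
def empF (v : Var) : Formula := all (.greek 5) (Formula.mem (Var.greek 5) v).neg

/-- The set `v` has the only element `t`. -/
def singF (v : Var) (t : Term) : Formula :=
  all (.greek 5) ((Formula.mem (Var.greek 5) v).iff (Formula.eq (Var.greek 5) t))

/-- The formula defining `Str.Code`. -/
def codeF (s y : Var) : Formula :=
  ex (.roman 0) ((Formula.eq (Var.roman 0) s).and
    (((empF (.roman 0)).and (Formula.eq y (twoT (Var.roman 0)))).or
      ((ex (.roman 1) (ex (.roman 2) ((singF (.roman 0) (twoT (Var.roman 1))).and
        ((singF (.roman 2) (Var.roman 1)).and (Formula.eq y (twoT (Var.roman 2))))))).or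
      ((empF (.roman 0)).neg.and
        ((ex (.roman 1) (singF (.roman 0) (twoT (Var.roman 1)))).neg.and
          (Formula.eq y (threeT (Var.roman 0))))))))

/-- The formula defining `Str.IsCode`, for `greek a`. -/
def isCodeF (a : ℕ) : Formula := ex (.roman 3) (codeF (.roman 3) (.greek a))

/-- The formula defining `Str.CodeMem`, for `greek a` and `greek b`. -/
def codeMemF (a b : ℕ) : Formula :=
  ex (.roman 3) ((codeF (.roman 3) (.greek b)).and (Formula.mem (Var.greek a) (Var.roman 3)))

/-- The formula defining `Str.WF`, for `greek a`. -/
def wfF (a : ℕ) : Formula :=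
  all (.roman 4) ((Formula.mem (Var.greek a) (Var.roman 4)).imp
    (ex (.greek 6) ((Formula.mem (Var.greek 6) (Var.roman 4)).and
      (all (.greek 7) ((codeMemF 7 6).imp (Formula.mem (Var.greek 7) (Var.roman 4)).neg)))))

variable {σ : Var → M.D}

@[simp] theorem eval_twoT (t : Term) : M.eval σ (twoT t) = M.two (M.eval σ t) := rfl
@[simp] theorem eval_threeT (t : Term) : M.eval σ (threeT t) = M.three (M.eval σ t) := rfl

theorem sat_codeF {s : Var} (hs : s ≠ .roman 0) (y : ℕ) :
    M.sat (codeF s (.greek y)) σ ↔ M.Code (σ s) (σ (.greek y)) := by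
  simp only [codeF, empF, singF, sat_ex, sat_and, sat_or, sat_neg, sat_all, sat_iff, sat_eq,
    sat_mem, eval_var, eval_twoT, eval_threeT]
  simp [hs, Code]

theorem sat_isCodeF (a : ℕ) : M.sat (isCodeF a) σ ↔ M.IsCode (σ (.greek a)) := by
  simp only [isCodeF, sat_ex, sat_codeF (s := .roman 3) (by simp), ok_roman, Function.update_self,
    Function.update_of_ne (a := Var.greek a) (a' := Var.roman 3) (by simp)]
  exact exists_congr fun s => ⟨fun h => h.2, fun h => ⟨h.1, h⟩⟩

theorem sat_codeMemF (a b : ℕ) :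
    M.sat (codeMemF a b) σ ↔ M.CodeMem (σ (.greek a)) (σ (.greek b)) := by
  simp only [codeMemF, sat_ex, sat_and, sat_mem, eval_var, sat_codeF (s := .roman 3) (by simp),
    ok_roman, Function.update_self, ne_eq, reduceCtorEq, not_false_eq_true,
    Function.update_of_ne]
  exact exists_congr fun s => ⟨fun h => h.2, fun h => ⟨h.1.1, h⟩⟩

theorem sat_wfF (a : ℕ) : M.sat (wfF a) σ ↔ M.WF (σ (.greek a)) := by
  simp [wfF, sat_codeMemF, WF]

/-- The Greek variable by which the interpretation represents the variable `v`. The Greek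
variables below `greek 8` are reserved for use as bound variables. -/
def repr : Var → ℕ
  | .roman i => 2 * i + 8
  | .greek i => 2 * i + 9

theorem repr_inj {v w : Var} (h : repr v = repr w) : v = w := by
  cases v <;> cases w <;> simp only [repr] at h <;> first | omega | (congr 1; omega)

theorem le_repr (v : Var) : 8 ≤ repr v := by
  cases v <;> simp only [repr] <;> omega

/-- The term of `M` that denotes the value of the given term of the interpretation. -/
def trT : Term → Term
  | .var v => .var (.greek (repr v))
  | .empty => twoT .empty
  | .mat m n t =>
    if m = 1 ∧ n = 1 then trT (t ⟨0, m.pos⟩ ⟨0, n.pos⟩)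
    else .mat (m + 1) n fun i j => if h : (i : ℕ) < m then trT (t ⟨i, h⟩ j) else .empty

/-- The translation of formulas about the interpretation into formulas about `M`. -/
def tr : Formula → Formula
  | falsum => falsum
  | .eq s t => .eq (trT s) (trT t)
  | .mem s t => ex (.greek 0) (ex (.greek 1) ((Formula.eq (Var.greek 0) (trT s)).and
      ((Formula.eq (Var.greek 1) (trT t)).and (codeMemF 0 1))))
  | imp φ ψ => (tr φ).imp (tr ψ)
  | all (.roman i) φ => all (.greek (repr (.roman i)))
      ((wfF (repr (.roman i))).imp ((isCodeF (repr (.roman i))).imp (tr φ)))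
  | all (.greek i) φ => all (.greek (repr (.greek i))) ((wfF (repr (.greek i))).imp (tr φ))

/-- The assignment `σ` in `M` represents the assignment `ρ` in the interpretation. -/
def Rep (hB : M.Basic) (σ : Var → M.D) (ρ : Var → hB.interp.D) : Prop :=
  ∀ v, σ (.greek (repr v)) = (ρ v).1

variable {hB : M.Basic} {ρ : Var → hB.interp.D}

theorem Rep.update (h : Rep hB σ ρ) (v : Var) (d : hB.interp.D) :
    Rep hB (Function.update σ (.greek (repr v)) d.1) (Function.update ρ v d) := by
  intro w
  by_cases e : w = v
  · subst e; simp
  · rw [Function.update_of_ne e, Function.update_of_ne, h w]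
    exact fun e' => e (repr_inj (Var.greek.inj e'))

theorem Rep.update_aux (h : Rep hB σ ρ) {k : ℕ} (hk : k < 8) (d : M.D) :
    Rep hB (Function.update σ (.greek k) d) ρ := by
  intro w
  rw [Function.update_of_ne, h w]
  intro e
  have := le_repr w
  rw [Var.greek.inj e] at this
  omega

theorem exists_rep (ρ : Var → hB.interp.D) : ∃ σ, M.Good σ ∧ Rep hB σ ρ := by
  classical
  refine ⟨fun v => if h : ∃ w, v = .greek (repr w) then (ρ h.choose).1 else M.e, ?_, fun v => ?_⟩
  · rintro (i | i)
    · simpa using hB.S_e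
    · trivial
  · have h : ∃ w, Var.greek (repr v) = .greek (repr w) := ⟨v, rfl⟩
    refine (dif_pos h).trans ?_
    rw [← repr_inj (Var.greek.inj h.choose_spec)]

theorem eval_trT (h : Rep hB σ ρ) (t : Term) :
    M.eval σ (trT t) = (hB.interp.eval ρ t).1 := by
  induction t with
  | var v => exact h v
  | empty => rfl
  | mat m n t ih =>
    rw [eval_mat, hB.interp_f_val, pad, trT]
    split_ifs with hmn
    · exact ih _ _
    · rw [eval_mat]
      congr 1
      funext i j
      split_ifs with hi
      · exact ih _ _
      · rfl

/-- The translation is correct; hence every relation definable in the interpretation is definable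
in `M`, and separation and replacement are inherited. -/
theorem sat_tr (h : Rep hB σ ρ) (φ : Formula) : M.sat (tr φ) σ ↔ hB.interp.sat φ ρ := by
  induction φ generalizing σ ρ with
  | falsum => rfl
  | eq s t =>
    rw [tr, sat_eq, sat_eq, eval_trT h, eval_trT h]
    exact Subtype.ext_iff.symm
  | mem s t =>
    have h₁ : ∀ d, Rep hB (Function.update σ (.greek 0) d) ρ := h.update_aux (by omega)
    have h₂ : ∀ d d', Rep hB (Function.update (Function.update σ (.greek 0) d) (.greek 1) d') ρ :=
      fun d => (h₁ d).update_aux (by omega)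
    simp only [tr, sat_ex, sat_and, sat_eq, eval_trT (h₂ _ _), sat_codeMemF, eval_var, sat_mem]
    simp [Basic.interp]
  | imp φ ψ ih₁ ih₂ => rw [tr, sat_imp, sat_imp, ih₁ h, ih₂ h]
  | all v φ ih =>
    cases v with
    | roman i =>
      simp only [tr, sat_all, sat_imp, sat_wfF, sat_isCodeF, Function.update_self, ok_greek,
        true_imp_iff]
      exact ⟨fun H d hd => (ih (h.update _ d)).1 (H d.1 d.2 hd),
        fun H d hd hd' => (ih (h.update _ ⟨d, hd⟩)).2 (H ⟨d, hd⟩ hd')⟩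
    | greek i =>
      simp only [tr, sat_all, sat_imp, sat_wfF, Function.update_self, ok_greek, true_imp_iff]
      exact ⟨fun H d => (ih (h.update _ d)).1 (H d.1 d.2),
        fun H d hd => (ih (h.update _ ⟨d, hd⟩)).2 (H ⟨d, hd⟩)⟩

/-! ### The interpretation satisfies the axioms -/

/-- Every set of well-founded objects is coded by a set of the interpretation. -/
theorem exists_interp_set (hB : M.Basic) {s : M.D} (hs : M.S s) (hwf : ∀ a, M.mem a s → M.WF a) :
    ∃ y : hB.interp.D, M.Code s y.1 ∧ hB.interp.S y ∧
      ∀ a : hB.interp.D, hB.interp.mem a y ↔ M.mem a.1 s := by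
  obtain ⟨y, hy⟩ := hB.exists_code hs
  exact ⟨⟨y, wf_of_codeMem_wf fun b hb => hwf b ((hB.codeMem_iff hy b).1 hb)⟩, hy, ⟨s, hy⟩,
    fun a => hB.codeMem_iff hy a.1⟩

/-- Every set of the interpretation codes a set of well-founded objects. -/
theorem exists_of_interp_set {y : hB.interp.D} (hy : hB.interp.S y) :
    ∃ s, M.S s ∧ M.Code s y.1 ∧ (∀ a, M.mem a s → M.WF a) ∧
      ∀ a : hB.interp.D, hB.interp.mem a y ↔ M.mem a.1 s := by
  obtain ⟨s, hs⟩ := hy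
  exact ⟨s, hs.1, hs, fun a ha => hB.wf_of_codeMem y.2 ⟨s, hs, ha⟩, fun a => hB.codeMem_iff hs a.1⟩

theorem interp_separation (hS : M.Separation) : hB.interp.Separation := by
  intro φ k ρ _ y hy
  obtain ⟨s, hs, -, hwf, hmem⟩ := exists_of_interp_set hy
  obtain ⟨σ, hσ, hrep⟩ := exists_rep ρ
  obtain ⟨t, ht, h⟩ := hS (tr φ) (repr (.greek k)) σ hσ s hs
  obtain ⟨r, -, hr, hr'⟩ := exists_interp_set hB ht fun a ha => hwf a ((h a).1 ha).1
  exact ⟨r, hr, fun a => by rw [hr', h, hmem, sat_tr (hrep.update _ a)]⟩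

theorem interp_replacement (hR : M.Replacement) : hB.interp.Replacement := by
  intro φ k l ρ hkl _ y hy hf
  obtain ⟨s, hs, -, hwf, hmem⟩ := exists_of_interp_set hy
  obtain ⟨σ, hσ, hrep⟩ := exists_rep ρ
  have key : ∀ a b : hB.interp.D, M.sat ((tr φ).and (wfF (repr (.greek l))))
      (Function.update (Function.update σ (.greek (repr (.greek k))) a.1)
        (.greek (repr (.greek l))) b.1) ↔
      hB.interp.sat φ (Function.update (Function.update ρ (.greek k) a) (.greek l) b) := by
    intro a b
    rw [sat_and, sat_tr ((hrep.update _ a).update _ b), sat_wfF, Function.update_self]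
    exact and_iff_left b.2
  have key' : ∀ a b, M.sat ((tr φ).and (wfF (repr (.greek l))))
      (Function.update (Function.update σ (.greek (repr (.greek k))) a)
        (.greek (repr (.greek l))) b) → M.WF b := by
    intro a b h
    rw [sat_and, sat_wfF, Function.update_self] at h
    exact h.2
  have hne : repr (.greek k) ≠ repr (.greek l) := fun e => hkl (Var.greek.inj (repr_inj e))
  have h := hR ((tr φ).and (wfF (repr (.greek l)))) _ _ σ hne hσ s hs fun a ha => ?_
  · obtain ⟨t, ht, h⟩ := h
    obtain ⟨r, -, hr, hr'⟩ := exists_interp_set hB ht fun b hb => by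
      obtain ⟨a, _, ha⟩ := (h b).1 hb
      exact key' a b ha
    refine ⟨r, hr, fun b => ?_⟩
    rw [hr', h]
    exact ⟨fun ⟨a, ha, h⟩ => ⟨⟨a, hwf a ha⟩, (hmem _).2 ha, (key ⟨a, hwf a ha⟩ b).1 h⟩,
      fun ⟨a, ha, h⟩ => ⟨a.1, (hmem a).1 ha, (key a b).2 h⟩⟩
  · obtain ⟨c, hc⟩ := hf ⟨a, hwf a ha⟩ ((hmem _).2 ha)
    refine ⟨c.1, fun b => ⟨fun h => ?_, ?_⟩⟩
    · exact congrArg Subtype.val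
        ((hc ⟨b, key' a b h⟩).1 ((key ⟨a, hwf a ha⟩ ⟨b, key' a b h⟩).1 h))
    · rintro rfl
      exact (key ⟨a, hwf a ha⟩ c).2 ((hc c).2 rfl)

theorem good_const (hB : M.Basic) : M.Good fun _ => M.e := by
  rintro (i | i)
  exacts [hB.S_e, trivial]

/-- The set of the codes of the elements of a set of sets. -/
theorem exists_image_code (hB : M.Basic) (hR : M.Replacement) {s : M.D} (hs : M.S s)
    (h : ∀ a, M.mem a s → M.S a) :
    ∃ t, M.S t ∧ ∀ b, M.mem b t ↔ ∃ a, M.mem a s ∧ M.Code a b := by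
  simpa [sat_codeF] using hR (codeF (.greek 0) (.greek 1)) 0 1 _ (by simp) (good_const hB) s hs
    fun a ha => by
      obtain ⟨c, hc⟩ := hB.exists_code (h a ha)
      refine ⟨c, fun b => ?_⟩
      rw [sat_codeF (by simp)]
      simp only [Function.update_self, ne_eq, Var.greek.injEq, zero_ne_one, not_false_eq_true,
        Function.update_of_ne]
      exact ⟨fun h => hB.code_unique h hc, fun h => h ▸ hc⟩

/-- The set of the sets coded by the elements of a set of codes. -/
theorem exists_preimage_code (hB : M.Basic) (hR : M.Replacement) {s : M.D} (hs : M.S s)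
    (h : ∀ a, M.mem a s → M.IsCode a) :
    ∃ t, M.S t ∧ ∀ b, M.mem b t ↔ ∃ a, M.mem a s ∧ M.Code b a := by
  simpa [sat_codeF] using hR (codeF (.greek 0) (.greek 1)) 1 0 _ (by simp) (good_const hB) s hs
    fun a ha => by
      obtain ⟨c, hc⟩ := h a ha
      refine ⟨c, fun b => ?_⟩
      rw [sat_codeF (by simp)]
      simp only [Function.update_self, ne_eq, Var.greek.injEq, one_ne_zero, not_false_eq_true,
        Function.update_of_ne]
      exact ⟨fun h => hB.code_inj h hc, fun h => h ▸ hc⟩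

theorem interp_pair (a b : hB.interp.D) :
    ∃ s, hB.interp.S s ∧ ∀ c, hB.interp.mem c s ↔ c = a ∨ c = b := by
  obtain ⟨s, hs, h⟩ := hB.pair a.1 b.1
  obtain ⟨r, -, hr, hr'⟩ := exists_interp_set hB hs fun c hc => by
    rcases (h c).1 hc with rfl | rfl
    exacts [a.2, b.2]
  exact ⟨r, hr, fun c => by rw [hr', h, hB.interp_ext_iff, hB.interp_ext_iff]⟩

theorem interp_union (hR : M.Replacement) (y : hB.interp.D) (hy : hB.interp.S y)
    (h : ∀ a, hB.interp.mem a y → hB.interp.S a) :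
    ∃ t, hB.interp.S t ∧
      ∀ b, hB.interp.mem b t ↔ ∃ r, hB.interp.S r ∧ hB.interp.mem r y ∧ hB.interp.mem b r := by
  obtain ⟨s, hs, -, hwf, hmem⟩ := exists_of_interp_set hy
  obtain ⟨p, hp, hp'⟩ := exists_preimage_code hB hR hs fun a ha =>
    h ⟨a, hwf a ha⟩ ((hmem _).2 ha)
  obtain ⟨q, hq, hq'⟩ := hB.union p hp fun a ha => by
    obtain ⟨b, _, hb⟩ := (hp' a).1 ha
    exact hb.1
  obtain ⟨t, -, ht, ht'⟩ := exists_interp_set hB hq fun b hb => by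
    obtain ⟨r, _, hr, hbr⟩ := (hq' b).1 hb
    obtain ⟨a, ha, hra⟩ := (hp' r).1 hr
    exact hB.wf_of_codeMem (hwf a ha) ⟨r, hra, hbr⟩
  refine ⟨t, ht, fun b => ?_⟩
  rw [ht', hq']
  constructor
  · rintro ⟨r, _, hr, hbr⟩
    obtain ⟨a, ha, hra⟩ := (hp' r).1 hr
    exact ⟨⟨a, hwf a ha⟩, ⟨r, hra⟩, (hmem _).2 ha, ⟨r, hra, hbr⟩⟩
  · rintro ⟨a, _, ha, r, hra, hbr⟩
    exact ⟨r, hra.1, (hp' r).2 ⟨a.1, (hmem a).1 ha, hra⟩, hbr⟩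

theorem interp_power (hR : M.Replacement) (y : hB.interp.D) (hy : hB.interp.S y) :
    ∃ t, hB.interp.S t ∧ ∀ a, hB.interp.mem a t ↔
      hB.interp.S a ∧ ∀ b, hB.interp.mem b a → hB.interp.mem b y := by
  obtain ⟨s, hs, -, hwf, hmem⟩ := exists_of_interp_set hy
  obtain ⟨p, hp, hp'⟩ := hB.power s hs
  obtain ⟨q, hq, hq'⟩ := exists_image_code hB hR hp fun a ha => ((hp' a).1 ha).1
  obtain ⟨t, -, ht, ht'⟩ := exists_interp_set hB hq fun b hb => by
    obtain ⟨a, ha, hab⟩ := (hq' b).1 hb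
    exact wf_of_codeMem_wf fun c hc =>
      hwf c (((hp' a).1 ha).2 c ((hB.codeMem_iff hab c).1 hc))
  refine ⟨t, ht, fun a => ?_⟩
  rw [ht', hq']
  constructor
  · rintro ⟨c, hc, hca⟩
    exact ⟨⟨c, hca⟩, fun b hb =>
      (hmem b).2 (((hp' c).1 hc).2 _ ((hB.codeMem_iff hca _).1 hb))⟩
  · rintro ⟨ha, h⟩
    obtain ⟨c, hc, hca, hwf', hmem'⟩ := exists_of_interp_set ha
    exact ⟨c, (hp' c).2 ⟨hc, fun b hb => (hmem ⟨b, hwf' b hb⟩).1 (h _ ((hmem' _).2 hb))⟩, hca⟩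

/-- The set of the `[z z]` with `z` an element of an infinite set of `M` is infinite in the sense
of the interpretation, as the code of `{[z z]}` is `[{z} {z}]`. -/
theorem interp_infinity (hS : M.Separation) (hR : M.Replacement) :
    ∃ s, hB.interp.S s ∧ hB.interp.mem hB.interp.e s ∧
      ∀ a, hB.interp.S a → hB.interp.mem a s →
        ∃ t, hB.interp.S t ∧ hB.interp.mem t s ∧ ∀ c, hB.interp.mem c t ↔ c = a := by
  obtain ⟨p, hp, hpe, hps⟩ := hB.infinity
  obtain ⟨q, hq, hq'⟩ : ∃ q, M.S q ∧ ∀ a, M.mem a q ↔ M.mem a p ∧ M.S a := by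
    simpa using hS (ex (.roman 0) (.eq (Var.roman 0) (Var.greek 0))) 0 _ (good_const hB) p hp
  obtain ⟨r, hr, hr'⟩ : ∃ r, M.S r ∧ ∀ b, M.mem b r ↔ ∃ a, M.mem a q ∧ b = M.two a := by
    simpa using hR (.eq (Var.greek 1) (twoT (Var.greek 0))) 0 1 _ (by simp) (good_const hB) q hq
      fun a _ => ⟨M.two a, fun b => by simp⟩
  obtain ⟨s, hs, hs'⟩ : ∃ s, M.S s ∧ ∀ a, M.mem a s ↔ M.mem a r ∧ M.WF a := by
    simpa [sat_wfF] using hS (wfF 0) 0 _ (good_const hB) r hr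
  obtain ⟨y, -, hy, hy'⟩ := exists_interp_set hB hs fun a ha => ((hs' a).1 ha).2
  refine ⟨y, hy, (hy' _).2 ((hs' _).2 ⟨(hr' _).2 ⟨_, (hq' _).2 ⟨hpe, hB.S_e⟩, rfl⟩, hB.wf_two_e⟩),
    fun a _ ha => ?_⟩
  obtain ⟨d, hd, hda⟩ := (hr' _).1 ((hs' _).1 ((hy' a).1 ha)).1
  obtain ⟨hdp, hdS⟩ := (hq' d).1 hd
  obtain ⟨t, ht, htp, ht'⟩ := hps d hdS hdp
  obtain ⟨c, hc, hc'⟩ := hB.exists_singleton (M.two d)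
  have hcode : M.Code c (M.two t) := ⟨hc, .inr (.inl ⟨d, hdS, t, ht, hc', ht', rfl⟩)⟩
  have hmem : ∀ b, M.CodeMem b (M.two t) ↔ b = a.1 := fun b => by
    rw [hB.codeMem_iff hcode, hc', hda]
  have hwf : M.WF (M.two t) := wf_of_codeMem_wf fun b hb => by
    rw [(hmem b).1 hb]
    exact a.2
  exact ⟨⟨_, hwf⟩, ⟨c, hcode⟩, (hy' _).2 ((hs' _).2 ⟨(hr' _).2 ⟨t, (hq' t).2 ⟨htp, ht⟩, rfl⟩, hwf⟩),
    fun b => (hmem b.1).trans Subtype.ext_iff.symm⟩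

theorem interp_mats (hS : M.Separation) (m n : ℕ+) (y : hB.interp.D) (hy : hB.interp.S y) :
    ∃ t, hB.interp.S t ∧ ∀ a, hB.interp.mem a t ↔
      ∃ b, a = hB.interp.f m n b ∧ ∀ i j, hB.interp.mem (b i j) y := by
  -- It suffices to find a set that contains all the matrices in question.
  suffices h : ∃ t, hB.interp.S t ∧ ∀ b, (∀ i j, hB.interp.mem (b i j) y) →
      hB.interp.mem (hB.interp.f m n b) t by
    obtain ⟨t, ht, h⟩ := h
    have hgood : hB.interp.Good fun _ => y := by
      rintro (i | i)
      exacts [hy, trivial]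
    obtain ⟨r, hr, hr'⟩ := interp_separation hS _ 0 _ hgood t ht
    refine ⟨r, hr, fun a => (hr' a).trans ?_⟩
    rw [sat_exs_matrix]
    exact ⟨fun h => by simpa [α, x] using h.2, fun ⟨b, h₁, h₂⟩ =>
      ⟨h₁ ▸ h b h₂, b, by simpa [α] using h₁, by simpa [x] using h₂⟩⟩
  by_cases hmn : ((1, 1) : ℕ+ × ℕ+) = (m, n)
  · obtain ⟨rfl, rfl⟩ := Prod.mk.inj hmn
    exact ⟨y, hy, fun b hb => hb _ _⟩
  · obtain ⟨s, hs, -, -, hmem⟩ := exists_of_interp_set hy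
    obtain ⟨s', hs', h'⟩ := hB.exists_insert hs M.e
    obtain ⟨p, hp, hp'⟩ := hB.mats (m + 1) n s' hs'
    obtain ⟨q, hq, hq'⟩ : ∃ q, M.S q ∧ ∀ a, M.mem a q ↔ M.mem a p ∧ M.WF a := by
      simpa [sat_wfF] using hS (wfF 0) 0 _ (good_const hB) p hp
    obtain ⟨t, -, ht, ht'⟩ := exists_interp_set hB hq fun a ha => ((hq' a).1 ha).2
    refine ⟨t, ht, fun b hb => (ht' _).2 ((hq' _).2
      ⟨(hp' _).2 ⟨_, (hB.interp_f_val b).trans (Basic.pad_of_ne hmn _), ?_⟩,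
      Subtype.property _⟩)⟩
    intro i j
    rw [h']
    split_ifs with hi
    · exact .inl ((hmem _).1 (hb _ _))
    · exact .inr rfl

theorem interp_basic (hS : M.Separation) (hR : M.Replacement) : hB.interp.Basic where
  f_one _ := rfl
  f_inj {m n a b} h := funext fun i => funext fun j => hB.interp_ext_iff.2 <|
    congrFun (congrFun (hB.pad_inj (a := fun i j => (a i j).1) (b := fun i j => (b i j).1)
      (hB.interp_ext_iff.1 h)) i) j
  f_ne {m n p q a b} h₁ h₂ h₃ h := hB.pad_ne (a := fun i j => (a i j).1)
    (b := fun i j => (b i j).1) h₁ h₂ h₃ (hB.interp_ext_iff.1 h)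
  ext {y y'} hy hy' h := by
    obtain ⟨s, hs, hsy, hwf, hmem⟩ := exists_of_interp_set hy
    obtain ⟨s', hs', hsy', hwf', hmem'⟩ := exists_of_interp_set hy'
    have e : s = s' := hB.ext hs hs' fun a =>
      ⟨fun ha => (hmem' ⟨a, hwf a ha⟩).1 ((h _).1 ((hmem _).2 ha)),
        fun ha => (hmem ⟨a, hwf' a ha⟩).1 ((h _).2 ((hmem' _).2 ha))⟩
    subst e
    exact Subtype.ext (hB.code_unique hsy hsy')
  S_e := ⟨M.e, hB.code_empty⟩
  not_mem_e a h := hB.not_mem_e _ ((hB.codeMem_iff hB.code_empty _).1 h)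
  pair := interp_pair
  union := interp_union hR
  power := interp_power hR
  infinity := interp_infinity hS hR
  mats := interp_mats hS

theorem one_one_ne_of_two_le {m n : ℕ+} (h : 2 ≤ (m * n : ℕ)) :
    ((1, 1) : ℕ+ × ℕ+) ≠ (m, n) := by
  intro e
  obtain ⟨rfl, rfl⟩ := Prod.mk.inj e
  simp at h

/-- The interpretation satisfies SMT and regularity. Padded matrices are not codes, and regularity
holds since all objects of the interpretation are well-founded. -/
theorem interp_models (hS : M.Separation) (hR : M.Replacement) :
    hB.interp.Models (SMT ∪ {regularityAxiom}) := by
  rintro φ (((h | ⟨m, n, h, rfl⟩) | ⟨m, n, h, rfl⟩) | rfl) σ hσ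
  · exact models_SMTminus (interp_basic hS hR) (interp_separation hS) (interp_replacement hR)
      φ h σ hσ
  · exact (sat_epsilonAxiom m n).2 fun a d ⟨s, hs, _⟩ =>
      hB.not_isCode_pad (one_one_ne_of_two_le h) (fun i j => (a i j).1) ⟨s, hs⟩
  · refine (sat_divisionAxiomSets m n).2 fun s hs a e => ?_
    rw [e] at hs
    exact hB.not_isCode_pad (one_one_ne_of_two_le h) (fun i j => (a i j).1) hs
  · refine sat_regularityAxiom.2 fun y hy ⟨a, ha⟩ => ?_
    obtain ⟨s, hs, -, hwf, hmem⟩ := exists_of_interp_set hy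
    obtain ⟨g, hg, hg'⟩ := a.2 s hs ((hmem a).1 ha)
    exact ⟨⟨g, hwf g hg⟩, (hmem _).2 hg, fun b hb hb' => hg' b.1 hb ((hmem b).1 hb')⟩

end Str

/-- SMT with regularity is consistent relative to SMT⁻, whether or not the latter includes
regularity. -/
theorem consistent_SMT_regularity (h : Consistent SMTminus) :
    Consistent (SMT ∪ {regularityAxiom}) := by
  obtain ⟨M, σ, hM, hσ⟩ := exists_model h
  have hB := Str.basic_of_models hM hσ
  have hI := Str.interp_models (hB := hB) (Str.separation_of_models hM)
    (Str.replacement_of_models hM)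
  refine Str.consistent hI (σ := fun _ => hB.interp.e) ?_
  rintro (i | i)
  exacts [⟨M.e, hB.code_empty⟩, trivial]

theorem Derives.mono {T T' : Set Formula} {φ : Formula} (hT : T ⊆ T') (h : Derives T φ) :
    Derives T' φ := by
  induction h with
  | ax h => exact .ax (hT h)
  | mp _ _ ih₁ ih₂ => exact .mp ih₁ ih₂
  | gen v _ ih => exact .gen v ih
  | imp_k φ ψ => exact .imp_k φ ψ
  | imp_s φ ψ χ => exact .imp_s φ ψ χ
  | dne φ => exact .dne φ
  | all_elim v t φ ha hf => exact .all_elim v t φ ha hf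
  | all_imp v φ ψ hv => exact .all_imp v φ ψ hv
  | eq_refl t => exact .eq_refl t
  | eq_subst i s t φ hs ht => exact .eq_subst i s t φ hs ht

theorem Consistent.mono {T T' : Set Formula} (hT : T ⊆ T') (h : Consistent T') : Consistent T :=
  fun h' => h (h'.mono hT)

end SetMatrix

theorem mainTheorem2 :
    (SetMatrix.Consistent SetMatrix.SMTminus → SetMatrix.Consistent SetMatrix.SMT) ∧
    (SetMatrix.Consistent (SetMatrix.SMTminus ∪ {SetMatrix.regularityAxiom}) →
      SetMatrix.Consistent (SetMatrix.SMT ∪ {SetMatrix.regularityAxiom})) :=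
  ⟨fun h => (SetMatrix.consistent_SMT_regularity h).mono Set.subset_union_left,
    fun h => SetMatrix.consistent_SMT_regularity (h.mono Set.subset_union_left)⟩
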